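/- Let $d\ge 1$, $x_0\in\mathbb R^d$, let $f:\mathbb R^d\to\mathbb R$ be measurable (the fidelity), let $0=w_0<w_1<\dots<w_c=w$, put $C_w=\{x:\|x-x_0\|_\infty\le w\}$ and $R_i=C_{w_i}\setminus C_{w_{i-1}}$ for $i=1,\dots,c$, and assume that $f$ is bounded below on $C_w$. Let $f^*_i=\inf_{R_i}f$ and $f^*_w=\inf_{C_w}f$. Let $\sigma_i>0$. In each region $R_i$, $Q\ge 2$ examples are sampled by one of two strategies (the same for all regions). *unif*: the examples are i.i.d. uniform in $R_i$. *i.i.d. unifI*: put $L=\lfloor\log_2 Q\rfloor$, $q=\lfloor Q/\log_2 Q\rfloor$, $n_m=\min(2^m,q)$; first draw independent uniform centres $r_{m,j}\in R_i$ ($1\le m\le L$, $1\le j\le n_m$); given the centres, the $Q$ examples are i.i.d. from the mixture $\sum_{m=1}^{L}\frac1L\sum_{j=1}^{n_m}\frac1{n_m}\,\mathcal N_{R_i}(r_{m,j},\sigma_i^2 I)$, where $\mathcal N_{R_i}(r,\sigma_i^2I)$ is the Gaussian distribution $\mathcal N(r,\sigma_i^2I)$ conditioned on $R_i$. Nothing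 is assumed on the joint distribution of the samples of different regions. Let $\hat f^*_i$ and $\hat{\hat f}{}^*_i$ be the smallest and second-smallest (with multiplicity) of the $Q$ sampled fidelities in $R_i$, and $\hat f^*_w=\min_i\hat f^*_i$. For $\kappa>0$ write $$G_i(\epsilon)=\Bigl(1+\frac{\hat{\hat f}{}^*_i-\hat f^*_i}{\epsilon}\Bigr)^{-\kappa}.$$ Say that region $i$ has *exponent* $\kappa$ if $F(f^*_i+\epsilon)\sim\eta\,\epsilon^\kappa$ as $\epsilon\to0^+$ for some $\eta>0$, where, for unif, $F$ is the cdf of $f(x)$ for $x$ uniform in $R_i$, and, for i.i.d. unifI, the relation is required for the cdf $F$ of $f(x)$, $x\sim\mathcal N_{R_i}(r,\sigma_i^2I)$, for every $r\in R_i$, with $\eta$ allowed to depend on $r$. Since $G_i(\epsilon)$ is random, the asymptotic equality $P[\hat f^*_i-f^*_i\le\epsilon]=G_i(\epsilon)$ is a statement about confidence levels. For $\alpha\in(0,1)$ let $\epsilon_{i,Q}(\alpha)>0$ be the (random) tolerance with $G_i(\epsilon_{i,Q}(\alpha))=\alpha$, which exists and is unique if $\hat{\hat f}{}^*_i>\hat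 f^*_i$, and let $\epsilon_{i,Q}(\alpha)$ be arbitrary if $\hat{\hat f}{}^*_i=\hat f^*_i$. (1) If region $i$ has exponent $\kappa>0$, then for every $\alpha\in(0,1)$ $$\lim_{Q\to\infty}P\bigl[\hat f^*_i-f^*_i\le\epsilon_{i,Q}(\alpha)\bigr]=\alpha ,$$ and for every fixed $\epsilon>0$, $\;P[\hat f^*_i-f^*_i\le\epsilon]-G_i(\epsilon)\to0$ in probability as $Q\to\infty$. (2) Let $i^*\in\arg\min_i f^*_i$ have exponent $\kappa>0$ and let $f^*_{i^*}\le f(x_0)$ (the point $x_0$ lies in none of the regions). Then $\epsilon_{i^*,Q}(\alpha)$ also serves for the overall minimum: for every $\alpha\in(0,1)$ $$\lim_{Q\to\infty}P\bigl[\hat f^*_{i^*}-f^*_w\le\epsilon_{i^*,Q}(\alpha)\bigr]=\alpha,\qquad \liminf_{Q\to\infty}P\bigl[\hat f^*_w-f^*_w\le\epsilon_{i^*,Q}(\alpha)\bigr]\ge\alpha ,$$ and for all fixed $\epsilon,\delta>0$, $\;P\bigl\{P[\hat f^*_w-f^*_w\le\epsilon]<G_{i^*}(\epsilon)-\delta\bigr\}\to0$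 as $Q\to\infty$. -/

import Mathlib

open MeasureTheory ProbabilityTheory Filter Topology Asymptotics
open scoped ENNReal NNReal

noncomputable section

namespace Ecertify

/-- The two i.i.d. sampling strategies. -/
inductive Strategy where
  | unif
  | iidUnifI

variable {d : ℕ}

/-- The hypercube (closed ball of the sup norm) of half-width `w` centred at `x₀`. -/
def cube (x₀ : Fin d → ℝ) (w : ℝ) : Set (Fin d → ℝ) :=
  {x | ∀ k, |x k - x₀ k| ≤ w}

/-- The region between two concentric hypercubes: the cube of half-width `ub` without the cube of
half-width `lb`. -/
def region (x₀ : Fin d → ℝ) (lb ub : ℝ) : Set (Fin d → ℝ) :=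
  cube x₀ ub \ cube x₀ lb

/-- The true minimum fidelity over a set. -/
def minFidelity (f : (Fin d → ℝ) → ℝ) (R : Set (Fin d → ℝ)) : ℝ :=
  sInf (f '' R)

/-- The uniform distribution on `R` (normalised Lebesgue measure). -/
def uniformIn (R : Set (Fin d → ℝ)) : Measure (Fin d → ℝ) :=
  cond volume R

/-- The isotropic Gaussian `N(r, σ² I)` conditioned to lie in `R`: the law of an example sampled
in `R` around the prototype `r`. -/
def gaussianIn (R : Set (Fin d → ℝ)) (σ : ℝ) (r : Fin d → ℝ) : Measure (Fin d → ℝ) :=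
  cond (Measure.pi fun k => gaussianReal (r k) (Real.toNNReal (σ ^ 2))) R

/-- The cdf at `v` of the fidelity of an example with distribution `ν`. -/
def fidelityCdf (f : (Fin d → ℝ) → ℝ) (ν : Measure (Fin d → ℝ)) (v : ℝ) : ℝ :=
  ν.real {x | f x ≤ v}

/-- The number `⌊log₂ Q⌋` of Gaussian mixtures in the outer mixture. -/
def numIter (Q : ℕ) : ℕ := ⌊Real.logb 2 Q⌋₊

/-- The budget `q = ⌊Q / log₂ Q⌋` of one iteration. -/
def iterBudget (Q : ℕ) : ℕ := ⌊(Q : ℝ) / Real.logb 2 Q⌋₊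

/-- The number `min (2 ^ i, q)` of prototypes in iteration `i = 1, …, ⌊log₂ Q⌋`; here `i` is
counted from `0`, whence the exponent `i + 1`. -/
def numProto (Q i : ℕ) : ℕ := min (2 ^ (i + 1)) (iterBudget Q)

/-- The prototypes (Gaussian centres) of all iterations. -/
abbrev Protos (d Q : ℕ) : Type :=
  (i : Fin (numIter Q)) → Fin (numProto Q i) → Fin d → ℝ

/-- The law of the prototypes: all of them independent and uniform in `R`. -/
def protoLaw (R : Set (Fin d → ℝ)) (Q : ℕ) : Measure (Protos d Q) :=
  Measure.pi fun _ => Measure.pi fun _ => uniformIn R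

/-- The mixture of Gaussian mixtures, with uniform weights on both levels, around given
prototypes. -/
def protoMixture (R : Set (Fin d → ℝ)) (σ : ℝ) (Q : ℕ) (r : Protos d Q) :
    Measure (Fin d → ℝ) :=
  ∑ i : Fin (numIter Q), (numIter Q : ℝ≥0∞)⁻¹ •
    ∑ j : Fin (numProto Q i), (numProto Q i : ℝ≥0∞)⁻¹ • gaussianIn R σ (r i j)

/-- The joint law of the `Q` examples queried in the region `R`. For `unif` they are i.i.d. uniform
in `R`. For `iidUnifI` the prototypes are sampled first and then, given the prototypes, the examples
are i.i.d. from the mixture around them. -/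
def sampleLaw (R : Set (Fin d → ℝ)) (σ : ℝ) (Q : ℕ) : Strategy → Measure (Fin Q → Fin d → ℝ)
  | .unif => Measure.pi fun _ => uniformIn R
  | .iidUnifI => (protoLaw R Q).bind fun r => Measure.pi fun _ => protoMixture R σ Q r

/-- The extreme-value regularity of the cdf of the fidelities at its lower end point,
`F (f* + ε) ≈ η ε ^ κ` as `ε → 0+` with `η > 0`. For `unif`, `F` is the cdf under uniform sampling
in `R`; for `iidUnifI` the condition is on the cdfs induced by the Gaussians around the
possible prototypes, where `η` may depend on the prototype. -/
def TailCondition (f : (Fin d → ℝ) → ℝ) (R : Set (Fin d → ℝ)) (σ κ : ℝ) : Strategy → Prop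
  | .unif => ∃ η : ℝ, 0 < η ∧
      (fun ε : ℝ => fidelityCdf f (uniformIn R) (minFidelity f R + ε))
        ~[𝓝[>] 0] fun ε => η * ε ^ κ
  | .iidUnifI => ∀ r ∈ R, ∃ η : ℝ, 0 < η ∧
      (fun ε : ℝ => fidelityCdf f (gaussianIn R σ r) (minFidelity f R + ε))
        ~[𝓝[>] 0] fun ε => η * ε ^ κ

/-- The order statistics, counted from `0` and with multiplicity: `orderStat v m` is the entry
number `m` of `v` sorted increasingly (a default value if there is no such entry). -/
def orderStat {Q : ℕ} (v : Fin Q → ℝ) (m : ℕ) : ℝ :=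
  if h : m < Q then v (Tuple.sort v ⟨m, h⟩) else 0

/-- The smallest sampled fidelity. -/
def smallest (f : (Fin d → ℝ) → ℝ) {Q : ℕ} (x : Fin Q → Fin d → ℝ) : ℝ :=
  orderStat (fun k => f (x k)) 0

/-- The second-smallest sampled fidelity. -/
def secondSmallest (f : (Fin d → ℝ) → ℝ) {Q : ℕ} (x : Fin Q → Fin d → ℝ) : ℝ :=
  orderStat (fun k => f (x k)) 1

/-- The cdf-free expression `(1 + (second smallest - smallest) / ε) ^ (-κ)`. -/
def evtBound (f : (Fin d → ℝ) → ℝ) (κ : ℝ) {Q : ℕ} (x : Fin Q → Fin d → ℝ) (ε : ℝ) : ℝ :=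
  (1 + (secondSmallest f x - smallest f x) / ε) ^ (-κ)

/-- `ε` is a tolerance, depending on the samples, at which the cdf-free expression has the value
`α`: for all samples `x Q ω` with distinct smallest and second-smallest fidelities, `ε Q ω` is a
positive solution of `evtBound = α`. (For tied samples the expression is constantly `1`, so there
is nothing to solve; `ε Q ω` is then arbitrary.) -/
def HasEvtLevel {Ω : Type*} (f : (Fin d → ℝ) → ℝ) (κ : ℝ)
    (x : (Q : ℕ) → Ω → Fin Q → Fin d → ℝ) (α : ℝ) (ε : ℕ → Ω → ℝ) : Prop :=
  ∀ Q, 2 ≤ Q → ∀ ω, smallest f (x Q ω) < secondSmallest f (x Q ω) →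
    0 < ε Q ω ∧ evtBound f κ (x Q ω) (ε Q ω) = α

end Ecertify

end

open Ecertify

/-! Put `Y = f - f*`, let `Y₁ ≤ Y₂` be its two smallest sampled values, and let `β = α ^ κ⁻¹`.
Solving `G(ε) = α` for `ε` turns the event `Y₁ ≤ ε` into `Y₁ ≤ β * Y₂`: the unknown `f*` drops out
of the tolerance (`smallest_sub_le_iff`). It remains to show that this ratio event has limiting
probability `β ^ κ = α`.

No extreme-value limit law is needed. For `Q` i.i.d. values with cdf `F`, let `M` be the minimum of
`Q - 1` of them. For `β < 1` at most one entry can lead by the factor `β`, so the event has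
probability `Q * E[F(β M)]`. Since `M` is small with overwhelming probability and `F(β z) ≈ β ^ κ *
F(z)` near `0`, this is about `β ^ κ * N` with `N = Q * E[F(M)]`. Some entry is always smallest,
hence `N ≥ 1`; and for `γ` just below `1`, `γ ^ κ * N` is nearly a probability, hence `N ≤ 1 +
o(1)`.

For i.i.d. unifI the examples are i.i.d. only given the centres, and the mixture changes with `Q`,
so every estimate is made uniform over a class of laws (`RegularClass`). The class of Gaussians
centred in the region qualifies because the region is totally bounded and nearby centres give laws
with density ratio close to `1`; mixtures preserve the defining inequalities because these are
linear in the law once the normaliser is cancelled.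

For a fixed `ε`, both the probability and `G(ε)` tend to `1`. For the overall minimum, `min_j` is at
most the value of region `i*` on every outcome, so no joint law of the regions enters. -/

namespace Ecertify

/-! ### Leading entries of an i.i.d. sample: exact formulas and estimates for one law -/

section Core

variable {E : Type*} [MeasurableSpace E]

/-- The samples whose entry number `k` has a value of at most `β` times every other value. -/
def leads (Y : E → ℝ) (β : ℝ) {Q : ℕ} (k : Fin Q) : Set (Fin Q → E) :=
  {x | ∀ j, j ≠ k → Y (x k) ≤ β * Y (x j)}

/-- The samples one of whose values is at most `β` times every other value. -/
def hasLeader (Y : E → ℝ) (β : ℝ) (Q : ℕ) : Set (Fin Q → E) :=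
  ⋃ k, leads Y β k

/-- The samples with at most one value in `(-∞, ε]`. -/
def lonely (Y : E → ℝ) (ε : ℝ) (Q : ℕ) : Set (Fin Q → E) :=
  ⋃ k, {x | ∀ j, j ≠ k → ε < Y (x j)}

variable {Y : E → ℝ}

theorem measurableSet_leads (hY : Measurable Y) (β : ℝ) {Q : ℕ} (k : Fin Q) :
    MeasurableSet (leads Y β k) := by
  unfold leads
  simp only [Set.ofPred_forall]
  refine MeasurableSet.iInter fun j => MeasurableSet.iInter fun _ => ?_
  exact measurableSet_le (hY.comp (measurable_pi_apply k))
    ((hY.comp (measurable_pi_apply j)).const_mul β)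

theorem measurableSet_hasLeader (hY : Measurable Y) (β : ℝ) (Q : ℕ) :
    MeasurableSet (hasLeader Y β Q) :=
  MeasurableSet.iUnion fun k => measurableSet_leads hY β k

theorem measurableSet_lonely (hY : Measurable Y) (ε : ℝ) (Q : ℕ) :
    MeasurableSet (lonely Y ε Q) := by
  refine MeasurableSet.iUnion fun k => ?_
  simp only [Set.ofPred_forall]
  refine MeasurableSet.iInter fun j => MeasurableSet.iInter fun _ => ?_
  exact measurableSet_lt measurable_const (hY.comp (measurable_pi_apply j))

/-- The probability, given the other entries `z`, that a further value is at most `β` times each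
of their values. -/
def leadProb (Y : E → ℝ) (ν : Measure E) (β : ℝ) {n : ℕ} (z : Fin n → E) : ℝ :=
  ν.real {y | ∀ j, Y y ≤ β * Y (z j)}

variable {ν : Measure E} [IsProbabilityMeasure ν]

theorem measurable_leadProb (hY : Measurable Y) (β : ℝ) (n : ℕ) :
    Measurable (leadProb Y ν β : (Fin n → E) → ℝ) := by
  have hs : MeasurableSet {p : E × (Fin n → E) | ∀ j, Y p.1 ≤ β * Y (p.2 j)} := by
    simp only [Set.ofPred_forall]
    refine MeasurableSet.iInter fun j => ?_
    exact measurableSet_le (hY.comp measurable_fst)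
      ((hY.comp ((measurable_pi_apply j).comp measurable_snd)).const_mul β)
  exact (measurable_measure_prodMk_right (μ := ν) hs).ennreal_toReal

theorem integrable_leadProb (hY : Measurable Y) (β : ℝ) (n : ℕ) :
    Integrable (leadProb Y ν β) (Measure.pi fun _ : Fin n => ν) := by
  refine Integrable.of_bound (measurable_leadProb hY β n).aestronglyMeasurable 1
    (ae_of_all _ fun z => ?_)
  rw [leadProb, Real.norm_of_nonneg measureReal_nonneg]
  exact measureReal_le_one

/-- Fubini after splitting off the coordinate `k`; the result does not depend on `k`. -/
theorem measureReal_leads (hY : Measurable Y) (β : ℝ) {n : ℕ} (k : Fin (n + 1)) :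
    (Measure.pi fun _ : Fin (n + 1) => ν).real (leads Y β k)
      = ∫ z, leadProb Y ν β z ∂(Measure.pi fun _ : Fin n => ν) := by
  have hs : MeasurableSet {p : E × (Fin n → E) | ∀ j, Y p.1 ≤ β * Y (p.2 j)} := by
    simp only [Set.ofPred_forall]
    refine MeasurableSet.iInter fun j => ?_
    exact measurableSet_le (hY.comp measurable_fst)
      ((hY.comp ((measurable_pi_apply j).comp measurable_snd)).const_mul β)
  have hpre : leads Y β k = (MeasurableEquiv.piFinSuccAbove (fun _ : Fin (n + 1) => E) k) ⁻¹'
      {p : E × (Fin n → E) | ∀ j, Y p.1 ≤ β * Y (p.2 j)} := by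
    ext x
    simp only [leads, Set.mem_ofPred_eq, Set.mem_preimage]
    constructor
    · intro h j
      exact h _ (Fin.succAbove_ne k j)
    · intro h j hj
      obtain ⟨i, rfl⟩ := Fin.exists_succAbove_eq hj
      exact h i
  have hmp := measurePreserving_piFinSuccAbove (fun _ : Fin (n + 1) => ν) k
  rw [hpre, measureReal_def, hmp.measure_preimage hs.nullMeasurableSet,
    Measure.prod_apply_symm hs]
  unfold leadProb Measure.real
  rw [integral_toReal]
  · rfl
  · exact (measurable_measure_prodMk_right (μ := ν) hs).aemeasurable
  · exact ae_of_all _ fun _ => measure_lt_top _ _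

theorem ae_forall_pos (hpos : ∀ᵐ x ∂ν, 0 < Y x) (Q : ℕ) :
    ∀ᵐ x ∂(Measure.pi fun _ : Fin Q => ν), ∀ k, 0 < Y (x k) :=
  ae_all_iff.2 fun k => (Measure.tendsto_eval_ae_ae (μ := fun _ : Fin Q => ν) (i := k)).eventually
    hpos

/-- Two distinct leaders `k`, `l` would give `Y_k + Y_l ≤ β * (Y_k + Y_l)`, impossible for positive
values and `β < 1`. The events are therefore almost surely disjoint and their probabilities add up.
-/
theorem measureReal_hasLeader (hY : Measurable Y) (hpos : ∀ᵐ x ∂ν, 0 < Y x) {β : ℝ}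
    (hβ : β < 1) (n : ℕ) :
    (Measure.pi fun _ : Fin (n + 1) => ν).real (hasLeader Y β (n + 1))
      = (n + 1) * ∫ z, leadProb Y ν β z ∂(Measure.pi fun _ : Fin n => ν) := by
  have hd : Pairwise (Function.onFun (AEDisjoint (Measure.pi fun _ : Fin (n + 1) => ν))
      fun k => leads Y β k) := by
    intro k l hkl
    refine measure_mono_null (t := {x | ¬ ∀ k, 0 < Y (x k)}) ?_ (ae_forall_pos hpos (n + 1))
    rintro x ⟨h1, h2⟩ h
    have h1 := h1 l hkl.symm
    have h2 := h2 k hkl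
    have := h k
    have := h l
    nlinarith
  rw [hasLeader, measureReal_def, measure_iUnion₀ hd
    fun k => (measurableSet_leads hY β k).nullMeasurableSet, tsum_fintype,
    ENNReal.toReal_sum fun _ _ => measure_ne_top _ _]
  simp only [← measureReal_def, measureReal_leads hY]
  simp

/-- A minimal entry always exists, so the events with `β = 1` cover everything. They overlap on
ties, which atoms of the cdf may cause, so only an inequality results. -/
theorem one_le_mul_integral_leadProb (hY : Measurable Y) (n : ℕ) :
    1 ≤ (n + 1) * ∫ z, leadProb Y ν 1 z ∂(Measure.pi fun _ : Fin n => ν) := by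
  have hu : hasLeader Y 1 (n + 1) = Set.univ := by
    refine Set.eq_univ_of_forall fun x => ?_
    obtain ⟨k, hk⟩ := Finite.exists_min fun k => Y (x k)
    exact Set.mem_iUnion.2 ⟨k, fun j _ => by simpa using hk j⟩
  have h := measureReal_iUnion_fintype_le (μ := Measure.pi fun _ : Fin (n + 1) => ν)
    fun k : Fin (n + 1) => leads Y 1 k
  have h1 : (Measure.pi fun _ : Fin (n + 1) => ν).real (⋃ k : Fin (n + 1), leads Y 1 k) = 1 := by
    have : (⋃ k : Fin (n + 1), leads Y 1 k) = Set.univ := hu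
    rw [this]; simp
  rw [h1] at h
  simpa [measureReal_leads hY] using h

theorem measureReal_forall_lt {ε b : ℝ} (hY : Measurable Y) (hb : b ≤ ν.real {x | Y x ≤ ε}) (n : ℕ) :
    (Measure.pi fun _ : Fin n => ν).real {z | ∀ j, ε < Y (z j)} ≤ (1 - b) ^ n := by
  have hset : {z : Fin n → E | ∀ j, ε < Y (z j)} = Set.univ.pi fun _ => {x | Y x ≤ ε}ᶜ := by
    ext z; simp
  rw [hset, measureReal_def, Measure.pi_pi]
  simp only [Finset.prod_const, Finset.card_univ, Fintype.card_fin, ENNReal.toReal_pow,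
    ← measureReal_def]
  rw [probReal_compl_eq_one_sub (measurableSet_le hY measurable_const)]
  exact pow_le_pow_left₀ (by linarith [measureReal_le_one (μ := ν) (s := {x | Y x ≤ ε})])
    (by linarith) n

theorem measureReal_lonely_le (hY : Measurable Y) {ε b : ℝ} (hb : b ≤ ν.real {x | Y x ≤ ε}) (n : ℕ) :
    (Measure.pi fun _ : Fin (n + 1) => ν).real (lonely Y ε (n + 1)) ≤ (n + 1) * (1 - b) ^ n := by
  have hk : ∀ k : Fin (n + 1), (Measure.pi fun _ : Fin (n + 1) => ν).real
      {x | ∀ j, j ≠ k → ε < Y (x j)} ≤ (1 - b) ^ n := by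
    intro k
    have hs : MeasurableSet {p : E × (Fin n → E) | ∀ j, ε < Y (p.2 j)} := by
      simp only [Set.ofPred_forall]
      exact MeasurableSet.iInter fun j => measurableSet_lt measurable_const
        (hY.comp ((measurable_pi_apply j).comp measurable_snd))
    have hpre : {x : Fin (n + 1) → E | ∀ j, j ≠ k → ε < Y (x j)}
        = (MeasurableEquiv.piFinSuccAbove (fun _ : Fin (n + 1) => E) k) ⁻¹'
          {p : E × (Fin n → E) | ∀ j, ε < Y (p.2 j)} := by
      ext x
      simp only [Set.mem_ofPred_eq, Set.mem_preimage]
      constructor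
      · intro h j
        exact h _ (Fin.succAbove_ne k j)
      · intro h j hj
        obtain ⟨i, rfl⟩ := Fin.exists_succAbove_eq hj
        exact h i
    have hmp := measurePreserving_piFinSuccAbove (fun _ : Fin (n + 1) => ν) k
    have hprod : {p : E × (Fin n → E) | ∀ j, ε < Y (p.2 j)}
        = Set.univ ×ˢ {z : Fin n → E | ∀ j, ε < Y (z j)} := by ext p; simp
    rw [hpre, measureReal_def, hmp.measure_preimage hs.nullMeasurableSet, hprod,
      Measure.prod_prod, measure_univ, one_mul]
    exact measureReal_forall_lt hY hb n
  refine (measureReal_iUnion_fintype_le _).trans ((Finset.sum_le_sum fun k _ => hk k).trans ?_)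
  simp

/-- Given the other entries, the lead probability is the cdf at `β` times their minimum. If that
minimum is at most `ε₀`, `hratio` applies; otherwise the error is at most `1`, on an event of
probability at most `(1 - b) ^ n`. -/
theorem abs_integral_leadProb_sub_le (hY : Measurable Y) (hpos : ∀ᵐ x ∂ν, 0 < Y x)
    {κ β δ ε₀ b : ℝ} (hβ0 : 0 < β) (hβ : β < 1) (hκ : 0 < κ) (hδ : 0 ≤ δ)
    (hb : b ≤ ν.real {x | Y x ≤ ε₀})
    (hratio : ∀ z, 0 < z → z ≤ ε₀ →
      |ν.real {x | Y x ≤ β * z} - β ^ κ * ν.real {x | Y x ≤ z}| ≤ δ * ν.real {x | Y x ≤ z})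
    {n : ℕ} (hn : 0 < n) :
    |∫ z, leadProb Y ν β z ∂(Measure.pi fun _ : Fin n => ν)
        - β ^ κ * ∫ z, leadProb Y ν 1 z ∂(Measure.pi fun _ : Fin n => ν)|
      ≤ δ * ∫ z, leadProb Y ν 1 z ∂(Measure.pi fun _ : Fin n => ν) + (1 - b) ^ n := by
  have : Nonempty (Fin n) := ⟨⟨0, hn⟩⟩
  set B : Set (Fin n → E) := {z | ∀ j, ε₀ < Y (z j)} with hB
  have hBm : MeasurableSet B := by
    simp only [hB, Set.ofPred_forall]
    exact MeasurableSet.iInter fun j => measurableSet_lt measurable_const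
      (hY.comp (measurable_pi_apply j))
  have hpt : ∀ᵐ z ∂(Measure.pi fun _ : Fin n => ν),
      |leadProb Y ν β z - β ^ κ * leadProb Y ν 1 z|
        ≤ δ * leadProb Y ν 1 z + B.indicator (fun _ => (1 : ℝ)) z := by
    filter_upwards [ae_forall_pos hpos n] with z hz
    obtain ⟨j₀, hj₀⟩ := Finite.exists_min fun j => Y (z j)
    have hset : ∀ t : ℝ, 0 < t → leadProb Y ν t z = ν.real {x | Y x ≤ t * Y (z j₀)} := by
      intro t ht
      unfold leadProb
      congr 1
      ext y
      exact ⟨fun h => h j₀, fun h j => le_trans h (mul_le_mul_of_nonneg_left (hj₀ j) ht.le)⟩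
    by_cases hm : Y (z j₀) ≤ ε₀
    · have hnB : z ∉ B := fun h => absurd (h j₀) (not_lt.2 hm)
      rw [Set.indicator_of_notMem hnB, add_zero, hset β hβ0, hset 1 one_pos, one_mul]
      exact hratio _ (hz j₀) hm
    · have hzB : z ∈ B := fun j => lt_of_lt_of_le (not_le.1 hm) (hj₀ j)
      rw [Set.indicator_of_mem hzB]
      have h1 : 0 ≤ leadProb Y ν β z := measureReal_nonneg
      have h2 : 0 ≤ leadProb Y ν 1 z := measureReal_nonneg
      have h3 : leadProb Y ν β z ≤ 1 := measureReal_le_one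
      have h4 : leadProb Y ν 1 z ≤ 1 := measureReal_le_one
      have h5 : 0 ≤ β ^ κ := (Real.rpow_pos_of_pos hβ0 κ).le
      have h6 : β ^ κ ≤ 1 := Real.rpow_le_one hβ0.le hβ.le hκ.le
      have h7 : β ^ κ * leadProb Y ν 1 z ≤ 1 := mul_le_one₀ h6 h2 h4
      have h8 : 0 ≤ β ^ κ * leadProb Y ν 1 z := mul_nonneg h5 h2
      have h9 : 0 ≤ δ * leadProb Y ν 1 z := mul_nonneg hδ h2
      rw [abs_le]
      constructor <;> linarith
  have hi := fun t => integrable_leadProb (ν := ν) hY t n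
  have hiB : Integrable (B.indicator fun _ => (1 : ℝ)) (Measure.pi fun _ : Fin n => ν) :=
    (integrable_const 1).indicator hBm
  rw [← integral_const_mul, ← integral_sub (hi β) ((hi 1).const_mul _)]
  refine (abs_integral_le_integral_abs).trans ?_
  refine (integral_mono_ae ((hi β).sub ((hi 1).const_mul _)).abs
    (((hi 1).const_mul δ).add hiB) hpt).trans ?_
  simp only [Pi.add_apply]
  rw [integral_add ((hi 1).const_mul δ) hiB, integral_const_mul, integral_indicator hBm]
  simp only [integral_const, smul_eq_mul, mul_one, measureReal_restrict_apply_univ]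
  gcongr
  exact measureReal_forall_lt hY hb n

end Core

/-! ### Limits that are uniform over a class of laws, and their transfer to mixtures of i.i.d.
samples -/

section Regular

variable {E : Type*} [MeasurableSpace E]

/-- A class of laws under which `Y` is positive, with cdfs of `Y` that are uniformly regularly
varying with index `κ` at `0` and uniformly bounded below at each positive point. -/
structure RegularClass (Y : E → ℝ) (κ : ℝ) (C : Set (Measure E)) : Prop where
  prob : ∀ ν ∈ C, IsProbabilityMeasure ν
  pos : ∀ ν ∈ C, ∀ᵐ x ∂ν, 0 < Y x
  ratio : ∀ β : ℝ, 0 < β → β < 1 → ∀ δ : ℝ, 0 < δ → ∃ ε₀ : ℝ, 0 < ε₀ ∧ ∀ ν ∈ C, ∀ z : ℝ, 0 < z →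
    z ≤ ε₀ → |ν.real {x | Y x ≤ β * z} - β ^ κ * ν.real {x | Y x ≤ z}| ≤ δ * ν.real {x | Y x ≤ z}
  lower : ∀ ε : ℝ, 0 < ε → ∃ b : ℝ, 0 < b ∧ ∀ ν ∈ C, b ≤ ν.real {x | Y x ≤ ε}

variable {Y : E → ℝ} {κ : ℝ} {C : Set (Measure E)}

theorem RegularClass.exists_lower (h : RegularClass Y κ C) {ε : ℝ} (hε : 0 < ε) :
    ∃ b : ℝ, 0 < b ∧ b ≤ 1 ∧ ∀ ν ∈ C, b ≤ ν.real {x | Y x ≤ ε} := by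
  obtain ⟨b, hb, h⟩ := h.lower ε hε
  exact ⟨min b 1, by positivity, min_le_right _ _, fun ν hν => (min_le_left _ _).trans (h ν hν)⟩

theorem tendsto_succ_mul_pow {b : ℝ} (hb : 0 < b) (hb1 : b ≤ 1) :
    Tendsto (fun n : ℕ => ((n : ℝ) + 1) * (1 - b) ^ n) atTop (𝓝 0) := by
  have h1 := tendsto_self_mul_const_pow_of_lt_one (r := 1 - b) (by linarith) (by linarith)
  have h2 := tendsto_pow_atTop_nhds_zero_of_lt_one (r := 1 - b) (by linarith) (by linarith)
  simpa [add_mul] using h1.add h2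

/-- Geometric decay of `(1 - b) ^ n` beats the factor `n + 1`; `ε₀` and `b` depend on the class
only, hence the uniformity. -/
theorem RegularClass.eventually_abs_sub_le (h : RegularClass Y κ C) (hY : Measurable Y)
    (hκ : 0 < κ) {β δ e : ℝ} (hβ0 : 0 < β) (hβ : β < 1) (hδ : 0 < δ) (he : 0 < e) :
    ∀ᶠ n : ℕ in atTop, ∀ ν ∈ C,
      |(n + 1) * ∫ z, leadProb Y ν β z ∂(Measure.pi fun _ : Fin n => ν)
        - β ^ κ * ((n + 1) * ∫ z, leadProb Y ν 1 z ∂(Measure.pi fun _ : Fin n => ν))|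
      ≤ δ * ((n + 1) * ∫ z, leadProb Y ν 1 z ∂(Measure.pi fun _ : Fin n => ν)) + e := by
  obtain ⟨ε₀, hε₀, hr⟩ := h.ratio β hβ0 hβ δ hδ
  obtain ⟨b, hb, hb1, hlow⟩ := h.exists_lower hε₀
  filter_upwards [eventually_gt_atTop 0, (tendsto_succ_mul_pow hb hb1).eventually_le_const he]
    with n hn hne ν hν
  have := h.prob ν hν
  have key := abs_integral_leadProb_sub_le hY (h.pos ν hν) hβ0 hβ hκ hδ.le (hlow ν hν) (hr ν hν) hn
  have hn1 : (0 : ℝ) < n + 1 := by positivity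
  calc _ = (n + 1) * |∫ z, leadProb Y ν β z ∂(Measure.pi fun _ : Fin n => ν)
        - β ^ κ * ∫ z, leadProb Y ν 1 z ∂(Measure.pi fun _ : Fin n => ν)| := by
        rw [← abs_of_pos hn1, ← abs_mul, abs_of_pos hn1]; congr 1; ring
    _ ≤ _ := (mul_le_mul_of_nonneg_left key hn1.le).trans (by linarith)

/-- Take `γ = (1 - τ / 8) ^ κ⁻¹ < 1`. The probability of a leader by the factor `γ` is at most `1`
and at least `(1 - τ / 8) * N - τ / 8 * N - τ / 2`. So `(1 - τ / 4) * N ≤ 1 + τ / 2`, which gives `N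
≤ 1 + τ` because `τ ≤ 1`. -/
theorem RegularClass.eventually_mul_integral_le (h : RegularClass Y κ C) (hY : Measurable Y)
    (hκ : 0 < κ) {τ : ℝ} (hτ : 0 < τ) (hτ1 : τ ≤ 1) :
    ∀ᶠ n : ℕ in atTop, ∀ ν ∈ C,
      (n + 1) * ∫ z, leadProb Y ν 1 z ∂(Measure.pi fun _ : Fin n => ν) ≤ 1 + τ := by
  have hs0 : 0 < 1 - τ / 8 := by linarith
  have hpow : ((1 - τ / 8) ^ κ⁻¹) ^ κ = 1 - τ / 8 := Real.rpow_inv_rpow hs0.le hκ.ne'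
  have hγ0 : 0 < (1 - τ / 8) ^ κ⁻¹ := Real.rpow_pos_of_pos hs0 _
  have hγ1 : (1 - τ / 8) ^ κ⁻¹ < 1 := Real.rpow_lt_one hs0.le (by linarith) (inv_pos.2 hκ)
  filter_upwards [h.eventually_abs_sub_le hY hκ hγ0 hγ1 (δ := τ / 8) (e := τ / 2) (by linarith)
    (by linarith)] with n hn ν hν
  have := h.prob ν hν
  have h1 := (abs_le.1 (hn ν hν)).1
  have h2 := measureReal_hasLeader hY (h.pos ν hν) hγ1 n
  have h3 : (Measure.pi fun _ : Fin (n + 1) => ν).real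
    (hasLeader Y ((1 - τ / 8) ^ κ⁻¹) (n + 1)) ≤ 1 := measureReal_le_one
  rw [h2] at h3
  rw [hpow] at h1
  generalize (n + 1) * ∫ z, leadProb Y ν 1 z ∂(Measure.pi fun _ : Fin n => ν) = N at *
  by_contra hN
  push Not at hN
  nlinarith

theorem RegularClass.eventually_hasLeader (h : RegularClass Y κ C) (hY : Measurable Y)
    (hκ : 0 < κ) {β τ : ℝ} (hβ0 : 0 < β) (hβ : β < 1) (hτ : 0 < τ) :
    ∀ᶠ Q : ℕ in atTop, ∀ ν ∈ C,
      |(Measure.pi fun _ : Fin Q => ν).real (hasLeader Y β Q) - β ^ κ| ≤ τ := by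
  have hτ' : 0 < min τ 1 := by positivity
  rw [← map_add_atTop_eq_nat 1, eventually_map]
  filter_upwards [h.eventually_mul_integral_le hY hκ (τ := min τ 1 / 4) (by linarith)
      (by linarith [min_le_right τ 1]),
    h.eventually_abs_sub_le hY hκ hβ0 hβ (δ := τ / 8) (e := τ / 4) (by linarith) (by linarith)]
    with n h1 h2 ν hν
  have := h.prob ν hν
  have h1 := h1 ν hν
  have h2 := abs_le.1 (h2 ν hν)
  have h3 := one_le_mul_integral_leadProb (ν := ν) hY n
  rw [measureReal_hasLeader hY (h.pos ν hν) hβ n]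
  have hp0 : 0 < β ^ κ := Real.rpow_pos_of_pos hβ0 κ
  have hp1 : β ^ κ ≤ 1 := Real.rpow_le_one hβ0.le hβ.le hκ.le
  generalize (n + 1) * ∫ z, leadProb Y ν 1 z ∂(Measure.pi fun _ : Fin n => ν) = N at *
  have hm1 := min_le_left τ 1
  have hm2 := min_le_right τ 1
  have h4 : τ / 8 * N ≤ τ / 8 * 2 := by gcongr; linarith
  have h5 : β ^ κ * (N - 1) ≤ 1 * (τ / 4) := by (gcongr; linarith)
  have h6 : 0 ≤ β ^ κ * (N - 1) := mul_nonneg hp0.le (by linarith)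
  rw [abs_le]
  constructor <;> linarith

theorem RegularClass.eventually_lonely (h : RegularClass Y κ C) (hY : Measurable Y)
    {ε τ : ℝ} (hε : 0 < ε) (hτ : 0 < τ) :
    ∀ᶠ Q : ℕ in atTop, ∀ ν ∈ C, (Measure.pi fun _ : Fin Q => ν).real (lonely Y ε Q) ≤ τ := by
  obtain ⟨b, hb, hb1, hlow⟩ := h.exists_lower hε
  rw [← map_add_atTop_eq_nat 1, eventually_map]
  filter_upwards [(tendsto_succ_mul_pow hb hb1).eventually_le_const hτ] with n hn ν hν
  have := h.prob ν hν
  exact (measureReal_lonely_le hY (hlow ν hν) n).trans hn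

/-- `S` is a law of samples that are i.i.d. given a random law from the class `C`. -/
structure IsMixtureOfIID {Q : ℕ} (C : Set (Measure E)) (S : Measure (Fin Q → E)) : Prop where
  prob : IsProbabilityMeasure S
  le : ∀ A : Set (Fin Q → E), MeasurableSet A → ∀ b : ℝ, 0 ≤ b →
    (∀ ν ∈ C, (Measure.pi fun _ : Fin Q => ν).real A ≤ b) → S.real A ≤ b

/-- Only upper bounds pass to the mixture by definition; the lower bound is the upper bound for the
complement. -/
theorem IsMixtureOfIID.abs_sub_le {Q : ℕ} {S : Measure (Fin Q → E)} (h : IsMixtureOfIID C S)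
    (hC : ∀ ν ∈ C, IsProbabilityMeasure ν) {A : Set (Fin Q → E)} (hA : MeasurableSet A) {p τ : ℝ}
    (hp0 : 0 ≤ p) (hp1 : p ≤ 1) (hτ : 0 ≤ τ)
    (hb : ∀ ν ∈ C, |(Measure.pi fun _ : Fin Q => ν).real A - p| ≤ τ) : |S.real A - p| ≤ τ := by
  have := h.prob
  have h1 := h.le A hA (p + τ) (by positivity) fun ν hν => by linarith [(abs_le.1 (hb ν hν)).2]
  have h2 := h.le Aᶜ hA.compl (1 - p + τ) (by linarith) fun ν hν => by
    have := hC ν hν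
    rw [probReal_compl_eq_one_sub hA]
    linarith [(abs_le.1 (hb ν hν)).1]
  rw [probReal_compl_eq_one_sub hA] at h2
  rw [abs_le]
  constructor <;> linarith

variable {Ω : Type*} [MeasurableSpace Ω] {P : Measure Ω} {X : (Q : ℕ) → Ω → Fin Q → E}
  {S : (Q : ℕ) → Measure (Fin Q → E)}

theorem RegularClass.tendsto_hasLeader (h : RegularClass Y κ C) (hY : Measurable Y)
    (hκ : 0 < κ) (hS : ∀ Q, 2 ≤ Q → IsMixtureOfIID C (S Q)) (hX : ∀ Q, 2 ≤ Q → HasLaw (X Q) (S Q) P)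
    {β : ℝ} (hβ0 : 0 < β) (hβ : β < 1) :
    Tendsto (fun Q => P.real {ω | X Q ω ∈ hasLeader Y β Q}) atTop (𝓝 (β ^ κ)) := by
  rw [Metric.tendsto_nhds]
  intro τ hτ
  filter_upwards [h.eventually_hasLeader hY hκ hβ0 hβ (half_pos hτ), eventually_ge_atTop 2]
    with Q hQ hQ2
  have h1 := (hX Q hQ2).measureReal_eq (p := fun x => x ∈ hasLeader Y β Q)
    (measurableSet_hasLeader hY β Q)
  rw [h1, Real.dist_eq]
  exact ((hS Q hQ2).abs_sub_le h.prob (measurableSet_hasLeader hY β Q)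
    (Real.rpow_nonneg hβ0.le κ) (Real.rpow_le_one hβ0.le hβ.le hκ.le) (half_pos hτ).le hQ).trans_lt
    (half_lt_self hτ)

theorem RegularClass.tendsto_lonely (h : RegularClass Y κ C) (hY : Measurable Y)
    (hS : ∀ Q, 2 ≤ Q → IsMixtureOfIID C (S Q)) (hX : ∀ Q, 2 ≤ Q → HasLaw (X Q) (S Q) P)
    {ε : ℝ} (hε : 0 < ε) :
    Tendsto (fun Q => P.real {ω | X Q ω ∈ lonely Y ε Q}) atTop (𝓝 0) := by
  rw [Metric.tendsto_nhds]
  intro τ hτ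
  filter_upwards [h.eventually_lonely hY hε (half_pos hτ), eventually_ge_atTop 2] with Q hQ hQ2
  have h1 := (hX Q hQ2).measureReal_eq (p := fun x => x ∈ lonely Y ε Q)
    (measurableSet_lonely hY ε Q)
  rw [h1, Real.dist_eq, sub_zero, abs_of_nonneg measureReal_nonneg]
  exact ((hS Q hQ2).le _ (measurableSet_lonely hY ε Q) _ (half_pos hτ).le hQ).trans_lt
    (half_lt_self hτ)

theorem RegularClass.ae_pos (h : RegularClass Y κ C) (hY : Measurable Y)
    (hS : ∀ Q, 2 ≤ Q → IsMixtureOfIID C (S Q)) (hX : ∀ Q, 2 ≤ Q → HasLaw (X Q) (S Q) P)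
    {Q : ℕ} (hQ : 2 ≤ Q) : ∀ᵐ ω ∂P, ∀ k, 0 < Y (X Q ω k) := by
  have hm : MeasurableSet {x : Fin Q → E | ∀ k, 0 < Y (x k)} := by
    simp only [Set.ofPred_forall]
    exact MeasurableSet.iInter fun j => measurableSet_lt measurable_const
      (hY.comp (measurable_pi_apply j))
  have := (hS Q hQ).prob
  rw [(hX Q hQ).ae_iff (p := fun x : Fin Q → E => ∀ k, 0 < Y (x k)) (measurableSet_setOfPred.1 hm)]
  have h0 := (hS Q hQ).le _ hm.compl 0 le_rfl fun ν hν => by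
    have := h.prob ν hν
    rw [measureReal_def, show Measure.pi (fun _ : Fin Q => ν) {x | ∀ k, 0 < Y (x k)}ᶜ = 0 from
      ae_forall_pos (h.pos ν hν) Q]
    simp
  have h1 := le_antisymm h0 measureReal_nonneg
  rwa [measureReal_eq_zero_iff] at h1

end Regular

/-! ### Regular classes: one law, a totally bounded family, mixtures -/

section Classes

variable {E : Type*} [MeasurableSpace E] {Y : E → ℝ} {κ : ℝ}

theorem regularClass_singleton {ν : Measure E} [IsProbabilityMeasure ν]
    {η : ℝ} (hκ : 0 < κ) (hη : 0 < η)
    (h : (fun z : ℝ => ν.real {x | Y x ≤ z}) ~[𝓝[>] 0] fun z => η * z ^ κ) :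
    RegularClass Y κ {ν} := by
  have hmono : Monotone fun z : ℝ => ν.real {x | Y x ≤ z} := fun s t hst =>
    measureReal_mono fun x hx => le_trans hx hst
  have hbound : ∀ c : ℝ, 0 < c → ∃ ε₀ : ℝ, 0 < ε₀ ∧ ∀ z, 0 < z → z ≤ ε₀ →
      |ν.real {x | Y x ≤ z} - η * z ^ κ| ≤ c * (η * z ^ κ) := by
    intro c hc
    have h1 := h.isLittleO.bound hc
    obtain ⟨u, hu, hu'⟩ := (mem_nhdsGT_iff_exists_Ioc_subset).1 h1
    refine ⟨u, hu, fun z hz hzu => ?_⟩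
    have h2 := hu' ⟨hz, hzu⟩
    have h3 : 0 ≤ η * z ^ κ := by positivity
    simpa [Real.norm_of_nonneg h3, Real.norm_eq_abs, abs_of_pos hη,
      abs_of_nonneg (Real.rpow_nonneg hz.le κ)] using h2
  refine ⟨?_, ?_, ?_, ?_⟩
  · intro μ hμ
    rw [Set.mem_singleton_iff.1 hμ]
    infer_instance
  · intro μ hμ
    rw [Set.mem_singleton_iff.1 hμ]
    have hlim : Tendsto (fun z : ℝ => η * z ^ κ) (𝓝[>] 0) (𝓝 0) := by
      have : Tendsto (fun z : ℝ => η * z ^ κ) (𝓝 0) (𝓝 (η * 0 ^ κ)) :=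
        ((Real.continuousAt_rpow_const 0 κ (Or.inr hκ.le)).tendsto).const_mul η
      rw [Real.zero_rpow hκ.ne', mul_zero] at this
      exact this.mono_left nhdsWithin_le_nhds
    have hlim' := (h.symm.tendsto_nhds hlim)
    -- The cdf tends to `0` at `0+`, so by monotonicity there is no mass on `Y ≤ 0`.
    have h0 : ν.real {x | Y x ≤ 0} ≤ 0 := by
      refine ge_of_tendsto hlim' ?_
      filter_upwards [self_mem_nhdsWithin] with z hz
      exact hmono (le_of_lt hz)
    have h1 := le_antisymm h0 measureReal_nonneg
    rw [measureReal_eq_zero_iff] at h1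
    have h2 : ∀ᵐ x ∂ν, ¬ Y x ≤ 0 := by
      rw [ae_iff]; simpa using h1
    filter_upwards [h2] with x hx using not_le.1 hx
  · intro β hβ0 hβ δ hδ
    -- With `T = η * z ^ κ`, the bound `δ / 4` makes the two approximation errors at most `δ * T /
    -- 2` together, and `1 / 2` gives `T / 2 ≤ F(z)`.
    obtain ⟨ε₀, hε₀, hc⟩ := hbound (min (δ / 4) (1 / 2)) (by positivity)
    refine ⟨ε₀, hε₀, ?_⟩
    intro μ hμ z hz hzε
    rw [Set.mem_singleton_iff.1 hμ]
    have h1 := abs_le.1 (hc z hz hzε)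
    have h2 := abs_le.1 (hc (β * z) (by positivity) (by nlinarith))
    rw [Real.mul_rpow hβ0.le hz.le] at h2
    have hp0 : 0 < β ^ κ := Real.rpow_pos_of_pos hβ0 κ
    have hp1 : β ^ κ ≤ 1 := Real.rpow_le_one hβ0.le hβ.le hκ.le
    have hT : 0 < η * z ^ κ := by positivity
    have hcc := min_le_left (δ / 4) (1 / 2 : ℝ)
    have hcc' := min_le_right (δ / 4) (1 / 2 : ℝ)
    have hc0 : 0 < min (δ / 4) (1 / 2 : ℝ) := by positivity
    rw [show η * (β ^ κ * z ^ κ) = β ^ κ * (η * z ^ κ) by ring] at h2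
    generalize min (δ / 4) (1 / 2 : ℝ) = c at *
    generalize η * z ^ κ = T at *
    generalize β ^ κ = p at *
    generalize ν.real {x | Y x ≤ z} = A at *
    generalize ν.real {x | Y x ≤ β * z} = B at *
    have h3 : c * (p * T) ≤ δ / 4 * T := by
      calc c * (p * T) = p * (c * T) := by ring
        _ ≤ 1 * (c * T) := by gcongr
        _ ≤ δ / 4 * T := by rw [one_mul]; gcongr
    have h4 : c * T ≤ 1 / 2 * T := by gcongr
    have h5 : δ * (T / 2) ≤ δ * A := mul_le_mul_of_nonneg_left (by linarith) hδ.le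
    have h6 : p * (A - T) ≤ p * (c * T) := by gcongr; linarith
    have h7 : p * (T - A) ≤ p * (c * T) := by gcongr; linarith
    rw [abs_le]
    constructor <;> linarith
  · intro ε hε
    obtain ⟨ε₀, hε₀, hc⟩ := hbound (1 / 2) (by norm_num)
    have hm : 0 < min ε ε₀ := by positivity
    have hT : 0 < η * min ε ε₀ ^ κ := by positivity
    refine ⟨1 / 2 * (η * min ε ε₀ ^ κ), by positivity, ?_⟩
    intro μ hμ
    rw [Set.mem_singleton_iff.1 hμ]
    have h1 := abs_le.1 (hc (min ε ε₀) hm (min_le_right _ _))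
    have h2 : ν.real {x | Y x ≤ min ε ε₀} ≤ ν.real {x | Y x ≤ ε} := hmono (min_le_left _ _)
    linarith

theorem exists_pos_forall_le {α : Type*} {t : Set α} (ht : t.Finite) {g : α → ℝ}
    (hg : ∀ r ∈ t, 0 < g r) : ∃ e : ℝ, 0 < e ∧ ∀ r ∈ t, e ≤ g r := by
  rcases t.eq_empty_or_nonempty with rfl | hne
  · exact ⟨1, one_pos, by simp⟩
  · obtain ⟨r₀, hr₀, hmin⟩ := Set.exists_min_image t g ht hne
    exact ⟨g r₀, hg r₀ hr₀, hmin⟩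

/-- A finite net of parameters has common constants, and `hclose`, used in both directions, carries
them to every other parameter at the cost of a factor near `1`. No uniformity of `η` in the
parameter is required. -/
theorem RegularClass.image_of_totallyBounded {α : Type*} [PseudoMetricSpace α] {s : Set α}
    (hs : TotallyBounded s) {ν : α → Measure E} (hκ : 0 < κ)
    (h : ∀ r ∈ s, RegularClass Y κ {ν r})
    (hclose : ∀ δ : ℝ, 0 < δ → ∃ θ : ℝ, 0 < θ ∧ ∀ r ∈ s, ∀ r' ∈ s, dist r r' < θ →
      ∀ A : Set E, MeasurableSet A → (ν r).real A ≤ (1 + δ) * (ν r').real A) (hY : Measurable Y) :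
    RegularClass Y κ (ν '' s) := by
  have hm : ∀ z : ℝ, MeasurableSet {x | Y x ≤ z} := fun z => measurableSet_le hY measurable_const
  refine ⟨?_, ?_, ?_, ?_⟩
  · rintro _ ⟨r, hr, rfl⟩
    exact (h r hr).prob _ rfl
  · rintro _ ⟨r, hr, rfl⟩
    exact (h r hr).pos _ rfl
  · intro β hβ0 hβ δ hδ
    -- Three errors arise: the ratio at the net point and the two changes of law. Since `B ≤ 5 / 4 *
    -- A`, they total at most `4 * δ' * A ≤ δ * A`.
    set δ' := min δ 1 / 4 with hδ'
    have hδ'0 : 0 < δ' := by positivity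
    have hδ'1 : 4 * δ' ≤ δ := by have := min_le_left δ 1; linarith
    have hδ'2 : 4 * δ' ≤ 1 := by have := min_le_right δ 1; linarith
    obtain ⟨θ, hθ, hcl⟩ := hclose δ' hδ'0
    obtain ⟨t, hts, htf, htc⟩ := Metric.finite_approx_of_totallyBounded hs θ hθ
    choose! ε₀ hε₀ hr using fun r (hr : r ∈ t) => (h r (hts hr)).ratio β hβ0 hβ δ' hδ'0
    obtain ⟨e, he0, he⟩ : ∃ e : ℝ, 0 < e ∧ ∀ r ∈ t, e ≤ ε₀ r := 
      exists_pos_forall_le htf hε₀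
    refine ⟨e, he0, ?_⟩
    rintro _ ⟨r, hrs, rfl⟩ z hz hze
    obtain ⟨c, hct, hc⟩ := Set.mem_iUnion₂.1 (htc hrs)
    have hd : dist r c < θ := hc
    have h1 := hcl r hrs c (hts hct) hd _ (hm z)
    have h2 := hcl c (hts hct) r hrs (by rwa [dist_comm]) _ (hm z)
    have h3 := hcl r hrs c (hts hct) hd _ (hm (β * z))
    have h4 := hcl c (hts hct) r hrs (by rwa [dist_comm]) _ (hm (β * z))
    have h5 := abs_le.1 (hr c hct _ rfl z hz (hze.trans (he c hct)))
    have hp0 : 0 < β ^ κ := Real.rpow_pos_of_pos hβ0 κ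
    have hp1 : β ^ κ ≤ 1 := Real.rpow_le_one hβ0.le hβ.le hκ.le
    have := (h r hrs).prob _ rfl
    have h6 : (ν r).real {x | Y x ≤ β * z} ≤ (ν r).real {x | Y x ≤ z} :=
      measureReal_mono fun x hx => le_trans hx (mul_le_of_le_one_left hz.le hβ.le)
    have := (h c (hts hct)).prob _ rfl
    have h7 : (ν c).real {x | Y x ≤ β * z} ≤ (ν c).real {x | Y x ≤ z} :=
      measureReal_mono fun x hx => le_trans hx (mul_le_of_le_one_left hz.le hβ.le)
    have hA0 : 0 ≤ (ν r).real {x | Y x ≤ z} := measureReal_nonneg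
    have hB0 : 0 ≤ (ν c).real {x | Y x ≤ z} := measureReal_nonneg
    generalize (ν r).real {x | Y x ≤ z} = A at *
    generalize (ν c).real {x | Y x ≤ z} = B at *
    generalize (ν r).real {x | Y x ≤ β * z} = A' at *
    generalize (ν c).real {x | Y x ≤ β * z} = B' at *
    generalize β ^ κ = p at *
    have k0 : δ' * B ≤ δ' * (5 / 4 * A) := by gcongr; nlinarith
    have k1 : p * (A - B) ≤ 1 * (δ' * B) := by
      calc p * (A - B) ≤ p * (δ' * B) := by gcongr; linarith
        _ ≤ 1 * (δ' * B) := by gcongr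
    have k2 : p * (B - A) ≤ 1 * (δ' * A) := by
      calc p * (B - A) ≤ p * (δ' * A) := by gcongr; linarith
        _ ≤ 1 * (δ' * A) := by gcongr
    have k3 : δ' * B' ≤ δ' * B := by gcongr
    have k4 : δ' * A' ≤ δ' * A := by gcongr
    have k5 : 4 * δ' * A ≤ δ * A := by gcongr
    have k6 : 0 ≤ δ' * A := by positivity
    rw [abs_le]
    constructor <;> linarith
  · intro ε hε
    obtain ⟨θ, hθ, hcl⟩ := hclose 1 one_pos
    obtain ⟨t, hts, htf, htc⟩ := Metric.finite_approx_of_totallyBounded hs θ hθ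
    choose! b hb hlow using fun r (hr : r ∈ t) => (h r (hts hr)).lower ε hε
    obtain ⟨e, he0, he⟩ : ∃ e : ℝ, 0 < e ∧ ∀ r ∈ t, e ≤ b r := 
      exists_pos_forall_le htf hb
    refine ⟨e / 2, half_pos he0, ?_⟩
    rintro _ ⟨r, hrs, rfl⟩
    obtain ⟨c, hct, hc⟩ := Set.mem_iUnion₂.1 (htc hrs)
    have h2 := hcl c (hts hct) r hrs (by rw [dist_comm]; exact hc) _ (hm ε)
    have := hlow c hct _ rfl
    have := he c hct
    linarith

/-- The finite mixtures of laws from the class `C`. -/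
def mixtures (C : Set (Measure E)) : Set (Measure E) :=
  {μ | ∃ (n : ℕ) (p : Fin n → ℝ≥0∞) (ν : Fin n → Measure E), ∑ i, p i = 1 ∧ (∀ i, ν i ∈ C) ∧
    μ = ∑ i, p i • ν i}

theorem measureReal_sum_smul {n : ℕ} {p : Fin n → ℝ≥0∞} (hp : ∑ i, p i = 1)
    {ν : Fin n → Measure E} (hν : ∀ i, IsProbabilityMeasure (ν i)) (A : Set E) :
    (∑ i, p i • ν i).real A = ∑ i, (p i).toReal * (ν i).real A := by
  have hp' : ∀ i, p i ≠ ∞ := fun i => ne_top_of_le_ne_top ENNReal.one_ne_top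
    (hp ▸ Finset.single_le_sum (fun _ _ => zero_le) (Finset.mem_univ i))
  simp only [measureReal_def, Measure.coe_finsetSum, Finset.sum_apply, Measure.smul_apply,
    smul_eq_mul]
  rw [ENNReal.toReal_sum fun i _ => ENNReal.mul_ne_top (hp' i) (measure_ne_top _ _)]
  simp

/-- The ratio bound has the cdf itself on its right-hand side, so it averages over the components
with the same `ε₀`, whatever their number and weights. -/
theorem RegularClass.mixtures {C : Set (Measure E)} (h : RegularClass Y κ C) :
    RegularClass Y κ (mixtures C) := by
  have hsum : ∀ {n : ℕ} {p : Fin n → ℝ≥0∞}, ∑ i, p i = 1 → ∑ i, (p i).toReal = 1 := by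
    intro n p hp
    have hp' : ∀ i, p i ≠ ∞ := fun i => ne_top_of_le_ne_top ENNReal.one_ne_top
      (hp ▸ Finset.single_le_sum (fun _ _ => zero_le) (Finset.mem_univ i))
    rw [← ENNReal.toReal_sum fun i _ => hp' i, hp, ENNReal.toReal_one]
  refine ⟨?_, ?_, ?_, ?_⟩
  · rintro _ ⟨n, p, ν, hp, hν, rfl⟩
    have hpr := fun i => h.prob _ (hν i)
    constructor
    simp [hp]
  · rintro _ ⟨n, p, ν, hp, hν, rfl⟩
    have hpos := fun i => h.pos _ (hν i)
    rw [ae_iff]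
    simp only [Measure.coe_finsetSum, Finset.sum_apply, Measure.smul_apply, smul_eq_mul]
    refine Finset.sum_eq_zero fun i _ => ?_
    rw [ae_iff.1 (hpos i), mul_zero]
  · intro β hβ0 hβ δ hδ
    obtain ⟨ε₀, hε₀, hr⟩ := h.ratio β hβ0 hβ δ hδ
    refine ⟨ε₀, hε₀, ?_⟩
    rintro _ ⟨n, p, ν, hp, hν, rfl⟩ z hz hzε
    have hpr := fun i => h.prob _ (hν i)
    rw [measureReal_sum_smul hp hpr, measureReal_sum_smul hp hpr, Finset.mul_sum, Finset.mul_sum,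
      ← Finset.sum_sub_distrib]
    refine (Finset.abs_sum_le_sum_abs _ _).trans (Finset.sum_le_sum fun i _ => ?_)
    rw [mul_left_comm, mul_left_comm δ, ← mul_sub, abs_mul, abs_of_nonneg ENNReal.toReal_nonneg]
    exact mul_le_mul_of_nonneg_left (hr _ (hν i) z hz hzε) ENNReal.toReal_nonneg
  · intro ε hε
    obtain ⟨b, hb, hlow⟩ := h.lower ε hε
    refine ⟨b, hb, ?_⟩
    rintro _ ⟨n, p, ν, hp, hν, rfl⟩
    have hpr := fun i => h.prob _ (hν i)
    rw [measureReal_sum_smul hp hpr]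
    calc b = ∑ i, (p i).toReal * b := by rw [← Finset.sum_mul, hsum hp, one_mul]
      _ ≤ _ := Finset.sum_le_sum fun i _ =>
        mul_le_mul_of_nonneg_left (hlow _ (hν i)) ENNReal.toReal_nonneg

end Classes

/-! ### Comparison of product measures and of Gaussians with nearby means -/

section PiComparison

variable {ι : Type*} [Fintype ι] {α : ι → Type*} [∀ i, MeasurableSpace (α i)]

theorem pi_mono_measure {μ ν : ∀ i, Measure (α i)} [∀ i, SigmaFinite (μ i)] (h : ∀ i, μ i ≤ ν i) :
    Measure.pi μ ≤ Measure.pi ν := by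
  have key : (Measure.pi μ).toOuterMeasure ≤ OuterMeasure.pi fun i => (ν i).toOuterMeasure := by
    rw [OuterMeasure.le_pi]
    intro s _
    exact (Measure.pi_pi μ s).le.trans (Finset.prod_le_prod' fun i _ => h i (s i))
  refine Measure.le_iff.2 fun s hs => ?_
  rw [Measure.pi_def ν, toMeasure_apply _ _ hs]
  exact key s

theorem pi_const_smul (μ : ∀ i, Measure (α i)) [∀ i, IsFiniteMeasure (μ i)] (c : ℝ≥0) :
    Measure.pi (fun i => c • μ i) = c ^ Fintype.card ι • Measure.pi μ := by
  refine Measure.pi_eq fun s _ => ?_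
  simp only [Measure.smul_apply, Measure.pi_pi]
  simp [ENNReal.smul_def, Finset.prod_mul_distrib]

end PiComparison

/-- The log-ratio of the densities is `(r - r') * (2 * x - r - r') / (2 * v)`, and `|2 * x - r - r'|
≤ 2 * (b - a)` on the interval. -/
theorem gaussianReal_restrict_le {a b θ : ℝ} {v : ℝ≥0} (hv : v ≠ 0) {r r' : ℝ}
    (hr : r ∈ Set.Icc a b) (hr' : r' ∈ Set.Icc a b) (hrr : |r - r'| ≤ θ) :
    (gaussianReal r v).restrict (Set.Icc a b)
      ≤ Real.toNNReal (Real.exp (θ * (b - a) / v)) • gaussianReal r' v := by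
  refine Measure.le_iff.2 fun s hs => ?_
  rw [Measure.restrict_apply hs, Measure.smul_apply, ENNReal.smul_def, smul_eq_mul,
    gaussianReal_apply _ hv, gaussianReal_apply _ hv]
  calc ∫⁻ x in s ∩ Set.Icc a b, gaussianPDF r v x
      ≤ ∫⁻ x in s ∩ Set.Icc a b,
          (Real.toNNReal (Real.exp (θ * (b - a) / v)) : ℝ≥0∞) * gaussianPDF r' v x := by
        refine setLIntegral_mono ((measurable_gaussianPDF _ _).const_mul _) fun x hx => ?_
        obtain ⟨-, hx1, hx2⟩ := hx
        change ENNReal.ofReal _ ≤ ENNReal.ofReal (Real.exp _) * ENNReal.ofReal _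
        rw [← ENNReal.ofReal_mul (Real.exp_pos _).le]
        refine ENNReal.ofReal_le_ofReal ?_
        rw [gaussianPDFReal, gaussianPDFReal, mul_left_comm, ← Real.exp_add]
        gcongr
        have hv' : (0 : ℝ) < v := by positivity
        rw [div_add_div _ _ hv'.ne' (by positivity), div_le_div_iff₀ (by positivity) (by positivity)]
        have h1 : (r - r') * (2 * x - r - r') ≤ θ * (2 * (b - a)) := by
          refine (le_abs_self _).trans ?_
          rw [abs_mul]
          refine mul_le_mul hrr ?_ (abs_nonneg _) ((abs_nonneg _).trans hrr)
          rw [abs_le]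
          constructor <;> linarith [hr.1, hr.2, hr'.1, hr'.2]
        have h2 : 0 ≤ (v : ℝ) * (2 * v) := by positivity
        nlinarith [mul_le_mul_of_nonneg_left h1 h2]
    _ ≤ ∫⁻ x in s, (Real.toNNReal (Real.exp (θ * (b - a) / v)) : ℝ≥0∞) * gaussianPDF r' v x :=
        lintegral_mono_set Set.inter_subset_left
    _ = _ := lintegral_const_mul _ (measurable_gaussianPDF _ _)

/-! ### Geometry of the regions and the conditioned Gaussians -/

section Region

variable {d : ℕ} {x₀ : Fin d → ℝ} {lb ub : ℝ}

theorem cube_eq_pi (x₀ : Fin d → ℝ) (w : ℝ) :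
    cube x₀ w = Set.univ.pi fun k => Set.Icc (x₀ k - w) (x₀ k + w) := by
  ext x
  simp only [cube, Set.mem_ofPred_eq, Set.mem_univ_pi, Set.mem_Icc, abs_le]
  refine forall_congr' fun k => ?_
  constructor <;> rintro ⟨h1, h2⟩ <;> constructor <;> linarith

theorem measurableSet_cube (x₀ : Fin d → ℝ) (w : ℝ) : MeasurableSet (cube x₀ w) := by
  rw [cube_eq_pi]
  exact MeasurableSet.univ_pi fun _ => measurableSet_Icc

theorem measurableSet_region (x₀ : Fin d → ℝ) (lb ub : ℝ) : MeasurableSet (region x₀ lb ub) :=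
  (measurableSet_cube x₀ ub).diff (measurableSet_cube x₀ lb)

theorem isBounded_cube (x₀ : Fin d → ℝ) (w : ℝ) : Bornology.IsBounded (cube x₀ w) := by
  rw [cube_eq_pi]
  exact Bornology.IsBounded.pi fun _ => Metric.isBounded_Icc _ _

theorem exists_isOpen_subset_region (hd : 0 < d) (hlb : 0 ≤ lb) (hub : lb < ub) :
    ∃ U : Set (Fin d → ℝ), IsOpen U ∧ U.Nonempty ∧ U ⊆ region x₀ lb ub := by
  -- One coordinate beyond `lb` already leaves the inner cube; the point offset by `(lb + ub) / 2`
  -- in each coordinate shows nonemptiness.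
  refine ⟨(⋂ k, {x | |x k - x₀ k| < ub}) ∩ {x | lb < |x ⟨0, hd⟩ - x₀ ⟨0, hd⟩|},
    (isOpen_iInter_of_finite fun k => isOpen_lt (by fun_prop) continuous_const).inter
      (isOpen_lt continuous_const (by fun_prop)), ⟨fun k => x₀ k + (lb + ub) / 2, ?_⟩, ?_⟩
  · simp only [Set.mem_inter_iff, Set.mem_iInter, Set.mem_ofPred_eq, add_sub_cancel_left]
    rw [abs_of_pos (by linarith)]
    exact ⟨fun _ => by linarith, by linarith⟩
  · rintro x ⟨h1, h2⟩
    refine ⟨fun k => le_of_lt (Set.mem_iInter.1 h1 k), fun h => ?_⟩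
    exact absurd (h ⟨0, hd⟩) (not_le.2 h2)

theorem region_nonempty (hd : 0 < d) (hlb : 0 ≤ lb) (hub : lb < ub) :
    (region x₀ lb ub).Nonempty := by
  obtain ⟨U, -, hU, hUR⟩ := exists_isOpen_subset_region (x₀ := x₀) hd hlb hub
  exact hU.mono hUR

theorem measure_region_ne_zero (hd : 0 < d) (hlb : 0 ≤ lb) (hub : lb < ub)
    (μ : Measure (Fin d → ℝ)) [μ.IsOpenPosMeasure] : μ (region x₀ lb ub) ≠ 0 := by
  obtain ⟨U, hUo, hU, hUR⟩ := exists_isOpen_subset_region (x₀ := x₀) hd hlb hub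
  exact fun h => (hUo.measure_pos μ hU).ne' (measure_mono_null hUR h)

theorem isProbabilityMeasure_uniformIn (hd : 0 < d) (hlb : 0 ≤ lb) (hub : lb < ub) :
    IsProbabilityMeasure (uniformIn (region x₀ lb ub)) :=
  cond_isProbabilityMeasure_of_finite (measure_region_ne_zero hd hlb hub volume)
    (((isBounded_cube x₀ ub).subset Set.sdiff_subset).measure_lt_top).ne

theorem pi_gaussianReal_region_ne_zero (hd : 0 < d) (hlb : 0 ≤ lb) (hub : lb < ub) {v : ℝ≥0}
    (hv : v ≠ 0) (r : Fin d → ℝ) :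
    Measure.pi (fun k => gaussianReal (r k) v) (region x₀ lb ub) ≠ 0 := by
  have : ∀ k, (gaussianReal (r k) v).IsOpenPosMeasure := fun k =>
    (gaussianReal_absolutelyContinuous' (r k) hv).isOpenPosMeasure
  exact measure_region_ne_zero hd hlb hub _

theorem isProbabilityMeasure_gaussianIn (hd : 0 < d) (hlb : 0 ≤ lb) (hub : lb < ub) {σ : ℝ}
    (hσ : 0 < σ) (r : Fin d → ℝ) : IsProbabilityMeasure (gaussianIn (region x₀ lb ub) σ r) :=
  cond_isProbabilityMeasure (pi_gaussianReal_region_ne_zero hd hlb hub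
    (Real.toNNReal_pos.2 (by positivity)).ne' r)

theorem pi_gaussianReal_le {w θ : ℝ} {v : ℝ≥0} (hv : v ≠ 0) {r r' : Fin d → ℝ}
    (hr : r ∈ cube x₀ w) (hr' : r' ∈ cube x₀ w) (hrr : dist r r' ≤ θ) {A : Set (Fin d → ℝ)}
    (hA : A ⊆ cube x₀ w) :
    Measure.pi (fun k => gaussianReal (r k) v) A
      ≤ (Real.toNNReal (Real.exp (θ * (2 * w) / v)) ^ d : ℝ≥0)
        * Measure.pi (fun k => gaussianReal (r' k) v) A := by
  rw [cube_eq_pi, Set.mem_univ_pi] at hr hr'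
  have h1 : ∀ k, (gaussianReal (r k) v).restrict (Set.Icc (x₀ k - w) (x₀ k + w))
      ≤ Real.toNNReal (Real.exp (θ * (2 * w) / v)) • gaussianReal (r' k) v := by
    intro k
    have := gaussianReal_restrict_le hv (hr k) (hr' k) (θ := θ)
      ((Real.dist_eq _ _ ▸ dist_le_pi_dist r r' k).trans hrr)
    rwa [show x₀ k + w - (x₀ k - w) = 2 * w by ring] at this
  have h2 := pi_mono_measure h1 A
  rw [← Measure.restrict_pi_pi, pi_const_smul, ← cube_eq_pi,
    Measure.restrict_eq_self _ hA, Fintype.card_fin] at h2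
  exact h2

/-- The exponent is `2 * d` because the `d`-fold comparison is used twice: for the mass of `A`
within the region and, with the centres swapped, for the normalising constant. -/
theorem gaussianIn_le (hd : 0 < d) (hlb : 0 ≤ lb) (hub : lb < ub) {σ θ : ℝ} (hσ : 0 < σ)
    {r r' : Fin d → ℝ} (hr : r ∈ region x₀ lb ub) (hr' : r' ∈ region x₀ lb ub)
    (hrr : dist r r' ≤ θ) (A : Set (Fin d → ℝ)) :
    (gaussianIn (region x₀ lb ub) σ r).real A
      ≤ Real.exp (θ * (2 * ub) / σ ^ 2) ^ (2 * d) * (gaussianIn (region x₀ lb ub) σ r').real A := by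
  have hv : Real.toNNReal (σ ^ 2) ≠ 0 := (Real.toNNReal_pos.2 (by positivity)).ne'
  have hvc : ((Real.toNNReal (σ ^ 2) : ℝ≥0) : ℝ) = σ ^ 2 := Real.coe_toNNReal _ (by positivity)
  have key : ∀ {s t : Fin d → ℝ}, s ∈ region x₀ lb ub → t ∈ region x₀ lb ub → dist s t ≤ θ →
      ∀ B ⊆ region x₀ lb ub,
      (Measure.pi fun k => gaussianReal (s k) (Real.toNNReal (σ ^ 2))).real B
        ≤ Real.exp (θ * (2 * ub) / σ ^ 2) ^ d
          * (Measure.pi fun k => gaussianReal (t k) (Real.toNNReal (σ ^ 2))).real B := by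
    intro s t hs ht hst B hB
    have h := ENNReal.toReal_mono (ENNReal.mul_ne_top ENNReal.coe_ne_top (measure_ne_top _ _))
      (pi_gaussianReal_le hv hs.1 ht.1 hst (hB.trans Set.sdiff_subset))
    rw [ENNReal.toReal_mul, hvc] at h
    simpa [Real.coe_toNNReal _ (Real.exp_pos _).le, measureReal_def] using h
  have hc : ∀ s : Fin d → ℝ, (gaussianIn (region x₀ lb ub) σ s).real A
      = ((Measure.pi fun k => gaussianReal (s k) (Real.toNNReal (σ ^ 2))).real
          (region x₀ lb ub))⁻¹
        * (Measure.pi fun k => gaussianReal (s k) (Real.toNNReal (σ ^ 2))).real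
          (region x₀ lb ub ∩ A) := by
    intro s
    rw [gaussianIn, measureReal_def, cond_apply (measurableSet_region x₀ lb ub), ENNReal.toReal_mul,
      ENNReal.toReal_inv]
    rfl
  have hp : ∀ s : Fin d → ℝ, 0 < (Measure.pi fun k =>
      gaussianReal (s k) (Real.toNNReal (σ ^ 2))).real (region x₀ lb ub) := fun s =>
    ENNReal.toReal_pos (pi_gaussianReal_region_ne_zero hd hlb hub hv s) (measure_ne_top _ _)
  rw [hc, hc]
  have h1 := key hr hr' hrr _ (Set.inter_subset_left (t := A))
  have h2 := key hr' hr (by rwa [dist_comm]) _ subset_rfl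
  have hp1 := hp r
  have hp2 := hp r'
  rw [pow_mul', sq (_ ^ d)]
  have hK : 0 < Real.exp (θ * (2 * ub) / σ ^ 2) ^ d := by positivity
  generalize Real.exp (θ * (2 * ub) / σ ^ 2) ^ d = K at *
  rw [inv_mul_eq_div, inv_mul_eq_div, ← mul_div_assoc, div_le_div_iff₀ hp1 hp2]
  calc _ ≤ (K * (Measure.pi fun k => gaussianReal (r' k) (Real.toNNReal (σ ^ 2))).real
          (region x₀ lb ub ∩ A)) * (K * (Measure.pi fun k =>
            gaussianReal (r k) (Real.toNNReal (σ ^ 2))).real (region x₀ lb ub)) := by gcongr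
    _ = _ := by ring

theorem exists_gaussianIn_le (hd : 0 < d) (hlb : 0 ≤ lb) (hub : lb < ub) {σ δ : ℝ} (hσ : 0 < σ)
    (hδ : 0 < δ) : ∃ θ : ℝ, 0 < θ ∧ ∀ r ∈ region x₀ lb ub, ∀ r' ∈ region x₀ lb ub, dist r r' < θ →
      ∀ A : Set (Fin d → ℝ), MeasurableSet A → (gaussianIn (region x₀ lb ub) σ r).real A
        ≤ (1 + δ) * (gaussianIn (region x₀ lb ub) σ r').real A := by
  have hcont : Continuous fun θ : ℝ => Real.exp (θ * (2 * ub) / σ ^ 2) ^ (2 * d) := by fun_prop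
  have hlim : Tendsto (fun θ : ℝ => Real.exp (θ * (2 * ub) / σ ^ 2) ^ (2 * d)) (𝓝[>] 0) (𝓝 1) := by
    have := hcont.tendsto 0
    simp only [zero_mul, zero_div, Real.exp_zero, one_pow] at this
    exact this.mono_left nhdsWithin_le_nhds
  obtain ⟨θ, hθ, hθ0⟩ := ((hlim.eventually_le_const (u := 1 + δ) (by linarith)).and
    self_mem_nhdsWithin).exists
  refine ⟨θ, hθ0, fun r hr r' hr' hrr A _ => ?_⟩
  exact (gaussianIn_le hd hlb hub hσ hr hr' hrr.le A).trans
    (mul_le_mul_of_nonneg_right hθ measureReal_nonneg)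

end Region

/-! ### The sampling laws as mixtures of i.i.d. laws from a regular class -/

section Laws

theorem sum_inv_smul_mem_mixtures {E : Type*} [MeasurableSpace E] {C : Set (Measure E)} {n : ℕ}
    (hn : 0 < n) {ν : Fin n → Measure E} (hν : ∀ i, ν i ∈ C) :
    ∑ i, (n : ℝ≥0∞)⁻¹ • ν i ∈ mixtures C := by
  refine ⟨n, fun _ => (n : ℝ≥0∞)⁻¹, ν, ?_, hν, rfl⟩
  rw [Finset.sum_const, Finset.card_univ, Fintype.card_fin, nsmul_eq_mul,
    ENNReal.mul_inv_cancel (by exact_mod_cast hn.ne') (ENNReal.natCast_ne_top n)]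

theorem one_le_logb_two {Q : ℕ} (hQ : 2 ≤ Q) : 1 ≤ Real.logb 2 Q := by
  have hQ' : (2 : ℝ) ≤ Q := by exact_mod_cast hQ
  rw [Real.le_logb_iff_rpow_le one_lt_two (by linarith), Real.rpow_one]
  exact hQ'

theorem numIter_pos {Q : ℕ} (hQ : 2 ≤ Q) : 0 < numIter Q :=
  Nat.floor_pos.2 (one_le_logb_two hQ)

theorem numProto_pos {Q : ℕ} (hQ : 2 ≤ Q) (i : ℕ) : 0 < numProto Q i := by
  have h1 := one_le_logb_two hQ
  have hQ' : (2 : ℝ) ≤ Q := by exact_mod_cast hQ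
  refine lt_min (by positivity) (Nat.floor_pos.2 ?_)
  rw [one_le_div (by linarith), Real.logb_le_iff_le_rpow one_lt_two (by linarith),
    Real.rpow_natCast]
  exact_mod_cast Nat.lt_two_pow_self.le

variable {d : ℕ} {x₀ : Fin d → ℝ} {lb ub : ℝ}

/-- The possible laws of an example, given the prototypes. -/
def exampleLaws (R : Set (Fin d → ℝ)) (σ : ℝ) : Strategy → Set (Measure (Fin d → ℝ))
  | .unif => {uniformIn R}
  | .iidUnifI => mixtures (mixtures (gaussianIn R σ '' R))

theorem regularClass_exampleLaws (hd : 0 < d) (hlb : 0 ≤ lb) (hub : lb < ub) {σ κ : ℝ}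
    (hσ : 0 < σ) (hκ : 0 < κ) {f : (Fin d → ℝ) → ℝ} (hf : Measurable f) {s : Strategy}
    (h : TailCondition f (region x₀ lb ub) σ κ s) :
    RegularClass (fun x => f x - minFidelity f (region x₀ lb ub)) κ
      (exampleLaws (region x₀ lb ub) σ s) := by
  have hcdf : ∀ ν : Measure (Fin d → ℝ), (fun z : ℝ => ν.real
      {x | f x - minFidelity f (region x₀ lb ub) ≤ z})
      = fun z => fidelityCdf f ν (minFidelity f (region x₀ lb ub) + z) := by
    intro ν
    funext z
    simp only [fidelityCdf, sub_le_iff_le_add']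
  cases s with
  | unif =>
    obtain ⟨η, hη, h⟩ := h
    have := isProbabilityMeasure_uniformIn (x₀ := x₀) hd hlb hub
    exact regularClass_singleton hκ hη (by rw [hcdf]; exact h)
  | iidUnifI =>
    refine RegularClass.mixtures (RegularClass.mixtures ?_)
    refine RegularClass.image_of_totallyBounded
      ((isBounded_cube x₀ ub).isCompact_closure.totallyBounded.subset
        (Set.sdiff_subset.trans subset_closure)) hκ (fun r hr => ?_)
      (fun δ hδ => exists_gaussianIn_le hd hlb hub hσ hδ) (hf.sub_const _)
    obtain ⟨η, hη, h⟩ := h r hr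
    have := isProbabilityMeasure_gaussianIn (x₀ := x₀) hd hlb hub hσ r
    exact regularClass_singleton hκ hη (by rw [hcdf]; exact h)

/-- The centres almost surely lie in the region, so the conditional law of an example almost surely
belongs to the class. The inequality `Measure.bind_apply_le` needs no measurability in the centres,
which is why `IsMixtureOfIID` asks for upper bounds only; total mass one is the hypothesis `hS`. -/
theorem isMixtureOfIID_sampleLaw (hd : 0 < d) (hlb : 0 ≤ lb) (hub : lb < ub) {σ : ℝ} {Q : ℕ}
    (hQ : 2 ≤ Q) {s : Strategy}
    (hprob : ∀ ν ∈ exampleLaws (region x₀ lb ub) σ s, IsProbabilityMeasure ν)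
    (hS : IsProbabilityMeasure (sampleLaw (region x₀ lb ub) σ Q s)) :
    IsMixtureOfIID (exampleLaws (region x₀ lb ub) σ s) (sampleLaw (region x₀ lb ub) σ Q s) := by
  refine ⟨hS, fun A hA b hb hle => ?_⟩
  have hu := isProbabilityMeasure_uniformIn (x₀ := x₀) hd hlb hub
  cases s with
  | unif => exact hle _ rfl
  | iidUnifI =>
    have hp : IsProbabilityMeasure (protoLaw (region x₀ lb ub) Q) := by
      unfold protoLaw; infer_instance
    have hmem : ∀ᵐ r ∂(protoLaw (region x₀ lb ub) Q), ∀ i j, r i j ∈ region x₀ lb ub := by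
      have h1 : ∀ n : ℕ, ∀ᵐ y ∂(Measure.pi fun _ : Fin n => uniformIn (region x₀ lb ub)),
          ∀ j, y j ∈ region x₀ lb ub := fun n => ae_all_iff.2 fun j =>
        (Measure.tendsto_eval_ae_ae (μ := fun _ : Fin n => uniformIn (region x₀ lb ub))
          (i := j)).eventually (ae_cond_mem (measurableSet_region x₀ lb ub))
      exact (ae_all_iff (ι := Fin (numIter Q))).2 fun i =>
        (Measure.tendsto_eval_ae_ae (μ := fun i : Fin (numIter Q) =>
          Measure.pi fun _ : Fin (numProto Q i) => uniformIn (region x₀ lb ub)) (i := i)).eventually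
          (h1 (numProto Q i))
    have hle' : sampleLaw (region x₀ lb ub) σ Q .iidUnifI A ≤ ENNReal.ofReal b := by
      refine (Measure.bind_apply_le _ hA).trans ?_
      calc _ ≤ ∫⁻ _, ENNReal.ofReal b ∂(protoLaw (region x₀ lb ub) Q) := by
            refine lintegral_mono_ae ?_
            filter_upwards [hmem] with r hr
            have hν : protoMixture (region x₀ lb ub) σ Q r
                ∈ exampleLaws (region x₀ lb ub) σ .iidUnifI :=
              sum_inv_smul_mem_mixtures (numIter_pos hQ) fun i =>
                sum_inv_smul_mem_mixtures (numProto_pos hQ i) fun j =>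
                  Set.mem_image_of_mem _ (hr i j)
            have := hprob _ hν
            rw [← ENNReal.ofReal_toReal (measure_ne_top
              (Measure.pi fun _ : Fin Q => protoMixture (region x₀ lb ub) σ Q r) A)]
            exact ENNReal.ofReal_le_ofReal (hle _ hν)
        _ = ENNReal.ofReal b := by simp
    exact ENNReal.toReal_le_of_le_ofReal hb hle'

/-! ### From order statistics and the tolerance to leading entries -/

section OrderStatistics

theorem exists_orderStat {Q : ℕ} (hQ : 2 ≤ Q) (v : Fin Q → ℝ) :
    ∃ k l : Fin Q, l ≠ k ∧ orderStat v 0 = v k ∧ orderStat v 1 = v l ∧ v k ≤ v l ∧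
      ∀ j, j ≠ k → v l ≤ v j := by
  have h0 : 0 < Q := by omega
  have h1 : 1 < Q := by omega
  have hm := Tuple.monotone_sort v
  refine ⟨Tuple.sort v ⟨0, h0⟩, Tuple.sort v ⟨1, h1⟩, ?_, ?_, ?_, ?_, ?_⟩
  · simp
  · simp [orderStat, h0]
  · simp [orderStat, h1]
  · exact hm (show (⟨0, h0⟩ : Fin Q) ≤ ⟨1, h1⟩ by simp)
  · intro j hj
    obtain ⟨i, rfl⟩ := (Tuple.sort v).surjective j
    refine hm (show (⟨1, h1⟩ : Fin Q) ≤ i from ?_)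
    have : i ≠ ⟨0, h0⟩ := fun h => hj (by rw [h])
    rw [Fin.le_def]
    have : (i : ℕ) ≠ 0 := fun h => this (Fin.ext h)
    show 1 ≤ (i : ℕ)
    omega

variable {f : (Fin d → ℝ) → ℝ} {a : ℝ} {Q : ℕ} {x : Fin Q → Fin d → ℝ}

theorem smallest_le_secondSmallest (hQ : 2 ≤ Q) (f : (Fin d → ℝ) → ℝ) (x : Fin Q → Fin d → ℝ) :
    smallest f x ≤ secondSmallest f x := by
  obtain ⟨k, l, -, h0, h1, hkl, -⟩ := exists_orderStat hQ fun k => f (x k)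
  rw [smallest, secondSmallest, h0, h1]
  exact hkl

theorem smallest_pos (hQ : 2 ≤ Q) (hx : ∀ k, 0 < f (x k) - a) : 0 < smallest f x - a := by
  obtain ⟨k, l, -, h0, -⟩ := exists_orderStat hQ fun k => f (x k)
  rw [smallest, h0]
  exact hx k

theorem mem_hasLeader_iff (hQ : 2 ≤ Q) (hx : ∀ k, 0 < f (x k) - a) {β : ℝ} (hβ0 : 0 < β) :
    x ∈ hasLeader (fun y => f y - a) β Q
      ↔ smallest f x - a ≤ β * (secondSmallest f x - a) := by
  obtain ⟨k, l, hlk, h0, h1, hkl, hmin⟩ := exists_orderStat hQ fun k => f (x k)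
  rw [smallest, secondSmallest, h0, h1]
  constructor
  · intro h
    obtain ⟨i, hi⟩ := Set.mem_iUnion.1 h
    by_cases hik : i = k
    · subst hik
      exact hi l hlk
    -- A leader `i` other than the minimiser `k` gives `Y_k ≤ Y_l ≤ Y_i ≤ β * Y_k ≤ β * Y_l`.
    · have h2 := hi k (Ne.symm hik)
      have h3 := hmin i hik
      have h4 := hx k
      simp only at h2 h3
      nlinarith
  · intro h
    refine Set.mem_iUnion.2 ⟨k, fun j hj => h.trans ?_⟩
    exact mul_le_mul_of_nonneg_left (sub_le_sub_right (hmin j hj) a) hβ0.le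

theorem mem_lonely_of_lt (hQ : 2 ≤ Q) {ε : ℝ} (h : ε < secondSmallest f x - a) :
    x ∈ lonely (fun y => f y - a) ε Q := by
  obtain ⟨k, l, -, -, h1, -, hmin⟩ := exists_orderStat hQ fun k => f (x k)
  rw [secondSmallest, h1] at h
  exact Set.mem_iUnion.2 ⟨k, fun j hj => h.trans_le (sub_le_sub_right (hmin j hj) a)⟩

/-- With `β = α ^ κ⁻¹`, the level equation reads `β * (ε + (m' - m)) = ε`. Hence `β * (m' - a) - (m
- a) = (1 - β) * (ε - (m - a))` for every `a`, and both sides have the same sign. -/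
theorem smallest_sub_le_iff {κ α ε : ℝ} (hκ : 0 < κ) (hα0 : 0 < α) (hα1 : α < 1)
    (hlt : smallest f x < secondSmallest f x) (hε : 0 < ε) (h : evtBound f κ x ε = α) :
    smallest f x - a ≤ ε ↔ smallest f x - a ≤ α ^ κ⁻¹ * (secondSmallest f x - a) := by
  have hβ0 : 0 < α ^ κ⁻¹ := Real.rpow_pos_of_pos hα0 _
  have hβ1 : α ^ κ⁻¹ < 1 := Real.rpow_lt_one hα0.le hα1 (inv_pos.2 hκ)
  have hgap : 0 < (secondSmallest f x - smallest f x) / ε := div_pos (sub_pos.2 hlt) hε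
  have hβ : α ^ κ⁻¹ = (1 + (secondSmallest f x - smallest f x) / ε)⁻¹ := by
    rw [← h, evtBound, ← Real.rpow_mul (by linarith), neg_mul, mul_inv_cancel₀ hκ.ne',
      Real.rpow_neg_one]
  have hkey : α ^ κ⁻¹ * (ε + (secondSmallest f x - smallest f x)) = ε := by
    rw [hβ, inv_mul_eq_div, div_eq_iff (by positivity)]
    field_simp
  generalize α ^ κ⁻¹ = β at *
  generalize smallest f x = m at *
  generalize secondSmallest f x = m' at *
  have hid : β * (m' - a) - (m - a) = (1 - β) * (ε - (m - a)) := by linear_combination hkey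
  rw [← sub_nonneg, ← sub_nonneg (a := β * (m' - a)), hid,
    mul_nonneg_iff_of_pos_left (by linarith)]

end OrderStatistics

end Laws

/-! ### Limits for one region -/

section Limits

variable {d : ℕ} {f : (Fin d → ℝ) → ℝ} {a κ : ℝ} {C : Set (Measure (Fin d → ℝ))}
  {Ω : Type*} [MeasurableSpace Ω] {P : Measure Ω} [IsProbabilityMeasure P]
  {X : (Q : ℕ) → Ω → Fin Q → Fin d → ℝ} {S : (Q : ℕ) → Measure (Fin Q → Fin d → ℝ)}

/-- No measurability of the sets is required, because the random tolerance is an arbitrary function.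
-/
theorem measureReal_le_add_of_ae {A B T : Set Ω} (h : ∀ᵐ ω ∂P, ω ∈ A → ω ∈ B ∨ ω ∈ T) :
    P.real A ≤ P.real B + P.real T :=
  (ENNReal.toReal_mono (measure_ne_top _ _) (measure_mono_ae (t := B ∪ T) h)).trans
    (measureReal_union_le B T)

/-- The cdf may have atoms, so ties can have positive probability. A tie of positive values excludes
a leader for every `β < 1`, and a leader has limiting probability `β ^ κ`, which is as close to `1`
as desired. -/
theorem RegularClass.tendsto_tie (h : RegularClass (fun x => f x - a) κ C) (hf : Measurable f)
    (hκ : 0 < κ) (hS : ∀ Q, 2 ≤ Q → IsMixtureOfIID C (S Q))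
    (hX : ∀ Q, 2 ≤ Q → HasLaw (X Q) (S Q) P) :
    Tendsto (fun Q => P.real {ω | ¬ smallest f (X Q ω) < secondSmallest f (X Q ω)}) atTop
      (𝓝 0) := by
  have hY : Measurable fun x => f x - a := hf.sub_const a
  rw [Metric.tendsto_nhds]
  intro τ hτ
  have hm1 := min_le_left τ 1
  have hm2 := min_le_right τ 1
  have hm : 0 < min τ 1 := by positivity
  set s := 1 - min τ 1 / 2 with hs
  have hs0 : 0 < s := by linarith
  have hβ0 : 0 < s ^ κ⁻¹ := Real.rpow_pos_of_pos hs0 _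
  have hβ1 : s ^ κ⁻¹ < 1 := Real.rpow_lt_one hs0.le (by linarith) (inv_pos.2 hκ)
  have hlim := h.tendsto_hasLeader hY hκ hS hX hβ0 hβ1
  rw [Real.rpow_inv_rpow hs0.le hκ.ne'] at hlim
  filter_upwards [hlim.eventually_const_lt (u := 1 - min τ 1) (by linarith),
    eventually_ge_atTop 2] with Q hQ hQ2
  rw [Real.dist_eq, sub_zero, abs_of_nonneg measureReal_nonneg]
  have hnull : NullMeasurableSet {ω | X Q ω ∈ hasLeader (fun x => f x - a) (s ^ κ⁻¹) Q} P :=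
    (hX Q hQ2).aemeasurable.nullMeasurable (measurableSet_hasLeader hY _ Q)
  have hle : P {ω | ¬ smallest f (X Q ω) < secondSmallest f (X Q ω)}
      ≤ P {ω | X Q ω ∈ hasLeader (fun x => f x - a) (s ^ κ⁻¹) Q}ᶜ := by
    refine measure_mono_ae ?_
    filter_upwards [h.ae_pos hY hS hX hQ2] with ω hω htie hlead
    have h1 := (mem_hasLeader_iff hQ2 hω hβ0).1 hlead
    have h2 := smallest_pos hQ2 hω
    have h3 : secondSmallest f (X Q ω) ≤ smallest f (X Q ω) := not_lt.1 htie
    have h4 := smallest_le_secondSmallest hQ2 f (X Q ω)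
    nlinarith
  have hle' := ENNReal.toReal_mono (measure_ne_top _ _) hle
  rw [← measureReal_def, ← measureReal_def, probReal_compl_eq_one_sub₀ hnull] at hle'
  linarith

theorem RegularClass.tendsto_level (h : RegularClass (fun x => f x - a) κ C) (hf : Measurable f)
    (hκ : 0 < κ) (hS : ∀ Q, 2 ≤ Q → IsMixtureOfIID C (S Q))
    (hX : ∀ Q, 2 ≤ Q → HasLaw (X Q) (S Q) P) {α : ℝ} (hα0 : 0 < α) (hα1 : α < 1)
    {ε : ℕ → Ω → ℝ} (hε : HasEvtLevel f κ X α ε) :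
    Tendsto (fun Q => P.real {ω | smallest f (X Q ω) - a ≤ ε Q ω}) atTop (𝓝 α) := by
  have hY : Measurable fun x => f x - a := hf.sub_const a
  have hβ0 : 0 < α ^ κ⁻¹ := Real.rpow_pos_of_pos hα0 _
  have hβ1 : α ^ κ⁻¹ < 1 := Real.rpow_lt_one hα0.le hα1 (inv_pos.2 hκ)
  have hlim := h.tendsto_hasLeader hY hκ hS hX hβ0 hβ1
  rw [Real.rpow_inv_rpow hα0.le hκ.ne'] at hlim
  have htie := h.tendsto_tie hf hκ hS hX
  have hiff : ∀ Q, 2 ≤ Q → ∀ᵐ ω ∂P, smallest f (X Q ω) < secondSmallest f (X Q ω) →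
      (smallest f (X Q ω) - a ≤ ε Q ω
        ↔ X Q ω ∈ hasLeader (fun x => f x - a) (α ^ κ⁻¹) Q) := by
    intro Q hQ
    filter_upwards [h.ae_pos hY hS hX hQ] with ω hω hlt
    obtain ⟨h1, h2⟩ := hε Q hQ ω hlt
    rw [mem_hasLeader_iff hQ hω hβ0]
    exact smallest_sub_le_iff hκ hα0 hα1 hlt h1 h2
  have hlow := hlim.sub htie
  have hupp := hlim.add htie
  rw [sub_zero] at hlow
  rw [add_zero] at hupp
  refine tendsto_of_tendsto_of_tendsto_of_le_of_le' hlow hupp ?_ ?_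
  · filter_upwards [eventually_ge_atTop 2] with Q hQ
    rw [sub_le_iff_le_add]
    refine measureReal_le_add_of_ae ?_
    filter_upwards [hiff Q hQ] with ω hω hmem
    by_cases hlt : smallest f (X Q ω) < secondSmallest f (X Q ω)
    · exact Or.inl ((hω hlt).2 hmem)
    · exact Or.inr hlt
  · filter_upwards [eventually_ge_atTop 2] with Q hQ
    refine measureReal_le_add_of_ae ?_
    filter_upwards [hiff Q hQ] with ω hω hmem
    by_cases hlt : smallest f (X Q ω) < secondSmallest f (X Q ω)
    · exact Or.inl ((hω hlt).1 hmem)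
    · exact Or.inr hlt

/-- Unless the sample is lonely, even the second-smallest value is within `ε` of `a`. -/
theorem RegularClass.tendsto_smallest (h : RegularClass (fun x => f x - a) κ C)
    (hf : Measurable f) (hS : ∀ Q, 2 ≤ Q → IsMixtureOfIID C (S Q))
    (hX : ∀ Q, 2 ≤ Q → HasLaw (X Q) (S Q) P) {ε : ℝ} (hε : 0 < ε) :
    Tendsto (fun Q => P.real {ω | smallest f (X Q ω) - a ≤ ε}) atTop (𝓝 1) := by
  have hlow := (h.tendsto_lonely (hf.sub_const a) hS hX hε).const_sub 1
  rw [sub_zero] at hlow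
  refine tendsto_of_tendsto_of_tendsto_of_le_of_le' hlow tendsto_const_nhds ?_
    (Eventually.of_forall fun Q => measureReal_le_one)
  filter_upwards [eventually_ge_atTop 2] with Q hQ
  rw [sub_le_iff_le_add, ← probReal_univ (μ := P)]
  refine measureReal_le_add_of_ae (ae_of_all _ fun ω _ => ?_)
  by_cases hω : ε < secondSmallest f (X Q ω) - a
  · exact Or.inr (mem_lonely_of_lt hQ hω)
  · exact Or.inl ((sub_le_sub_right (smallest_le_secondSmallest hQ f (X Q ω)) a).trans
      (not_lt.1 hω))

theorem evtBound_le_one {Q : ℕ} (hQ : 2 ≤ Q) (hκ : 0 < κ) {ε : ℝ} (hε : 0 < ε)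
    (x : Fin Q → Fin d → ℝ) : evtBound f κ x ε ≤ 1 := by
  have h1 : 0 ≤ (secondSmallest f x - smallest f x) / ε :=
    div_nonneg (sub_nonneg.2 (smallest_le_secondSmallest hQ f x)) hε.le
  exact Real.rpow_le_one_of_one_le_of_nonpos (by linarith) (by linarith)

theorem RegularClass.tendstoInMeasure (h : RegularClass (fun x => f x - a) κ C)
    (hf : Measurable f) (hκ : 0 < κ) (hS : ∀ Q, 2 ≤ Q → IsMixtureOfIID C (S Q))
    (hX : ∀ Q, 2 ≤ Q → HasLaw (X Q) (S Q) P) {ε : ℝ} (hε : 0 < ε) :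
    TendstoInMeasure P (fun Q ω => P.real {ω' | smallest f (X Q ω') - a ≤ ε}
      - evtBound f κ (X Q ω) ε) atTop (fun _ => 0) := by
  have hY : Measurable fun x => f x - a := hf.sub_const a
  rw [tendstoInMeasure_iff_measureReal_dist]
  intro τ hτ
  -- A gap of at most `ε'` forces `G(ε) > 1 - τ`. A larger gap requires `Y₂ > ε'`, hence a lonely
  -- sample.
  obtain ⟨ε', hε', hevt⟩ : ∃ ε' : ℝ, 0 < ε' ∧ 1 - τ < (1 + ε' / ε) ^ (-κ) := by
    have hlim : Tendsto (fun u : ℝ => (1 + u / ε) ^ (-κ)) (𝓝[>] 0) (𝓝 1) := by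
      have hc : ContinuousAt (fun u : ℝ => (1 + u / ε) ^ (-κ)) 0 :=
        ContinuousAt.rpow_const (by fun_prop) (Or.inl (by simp))
      have := hc.tendsto
      simp only [zero_div, add_zero, Real.one_rpow] at this
      exact this.mono_left nhdsWithin_le_nhds
    obtain ⟨u, hu, hu0⟩ := ((hlim.eventually_const_lt (u := 1 - τ) (by linarith)).and
      self_mem_nhdsWithin).exists
    exact ⟨u, hu0, hu⟩
  refine squeeze_zero' (Eventually.of_forall fun _ => measureReal_nonneg) ?_
    (h.tendsto_lonely hY hS hX hε')
  filter_upwards [(h.tendsto_smallest hf hS hX hε).eventually_const_lt (u := 1 - τ)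
    (by linarith), eventually_ge_atTop 2] with Q hQ hQ2
  refine ENNReal.toReal_mono (measure_ne_top _ _) (measure_mono_ae ?_)
  filter_upwards [h.ae_pos hY hS hX hQ2] with ω hω hdist
  by_contra hlonely
  have h1 : secondSmallest f (X Q ω) - a ≤ ε' :=
    not_lt.1 fun hlt => hlonely (mem_lonely_of_lt hQ2 hlt)
  have h2 := smallest_pos hQ2 hω
  have h3 := evtBound_le_one (f := f) hQ2 hκ hε (X Q ω)
  have h4 : 0 ≤ (secondSmallest f (X Q ω) - smallest f (X Q ω)) / ε :=
    div_nonneg (sub_nonneg.2 (smallest_le_secondSmallest hQ2 f (X Q ω))) hε.le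
  have h5 : (1 + ε' / ε) ^ (-κ) ≤ evtBound f κ (X Q ω) ε := by
    refine Real.rpow_le_rpow_of_nonpos (by linarith) ?_ (by linarith)
    gcongr
    linarith
  have h6 : P.real {ω' | smallest f (X Q ω') - a ≤ ε} ≤ 1 := measureReal_le_one
  have h7 : τ ≤ dist (P.real {ω' | smallest f (X Q ω') - a ≤ ε} - evtBound f κ (X Q ω) ε) 0 :=
    hdist
  rw [Real.dist_eq, sub_zero] at h7
  refine absurd h7 (not_le.2 (abs_lt.2 ⟨?_, ?_⟩)) <;> linarith

end Limits

/-! ### The cube as the union of its centre and the regions -/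

section Partition

variable {d : ℕ} {x₀ : Fin d → ℝ}

theorem cube_mono {u v : ℝ} (h : u ≤ v) : cube x₀ u ⊆ cube x₀ v :=
  fun _ hx k => (hx k).trans h

theorem mem_cube_zero_iff {x : Fin d → ℝ} : x ∈ cube x₀ 0 ↔ x = x₀ := by
  simp only [cube, Set.mem_ofPred_eq, abs_nonpos_iff, sub_eq_zero, funext_iff]

theorem mem_cube_zero_or_mem_region {c : ℕ} (w : Fin (c + 1) → ℝ) {x : Fin d → ℝ}
    (j : Fin (c + 1)) (hx : x ∈ cube x₀ (w j)) :
    x ∈ cube x₀ (w 0) ∨ ∃ i : Fin c, x ∈ region x₀ (w i.castSucc) (w i.succ) := by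
  induction j using Fin.induction with
  | zero => exact Or.inl hx
  | succ i ih =>
    by_cases h : x ∈ cube x₀ (w i.castSucc)
    · exact ih h
    · exact Or.inr ⟨i, hx, h⟩

theorem minFidelity_cube_eq {c : ℕ} {w : Fin (c + 1) → ℝ} (hw0 : w 0 = 0) (hw : StrictMono w)
    (hd : 0 < d) {f : (Fin d → ℝ) → ℝ} (hbdd : BddBelow (f '' cube x₀ (w (Fin.last c)))) {i : Fin c}
    (hi : ∀ j : Fin c, minFidelity f (region x₀ (w i.castSucc) (w i.succ))
      ≤ minFidelity f (region x₀ (w j.castSucc) (w j.succ)))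
    (h0 : minFidelity f (region x₀ (w i.castSucc) (w i.succ)) ≤ f x₀) :
    minFidelity f (cube x₀ (w (Fin.last c)))
      = minFidelity f (region x₀ (w i.castSucc) (w i.succ)) := by
  have hsub : ∀ j : Fin c, region x₀ (w j.castSucc) (w j.succ) ⊆ cube x₀ (w (Fin.last c)) :=
    fun j => Set.sdiff_subset.trans (cube_mono (hw.monotone (Fin.le_last _)))
  have hne : (region x₀ (w i.castSucc) (w i.succ)).Nonempty :=
    region_nonempty hd (hw0 ▸ hw.monotone (Fin.zero_le _)) (hw Fin.castSucc_lt_succ)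
  refine le_antisymm (csInf_le_csInf hbdd (hne.image f) (Set.image_mono (hsub i))) ?_
  refine le_csInf ((hne.mono (hsub i)).image f) ?_
  rintro _ ⟨x, hx, rfl⟩
  rcases mem_cube_zero_or_mem_region w _ hx with h | ⟨j, hj⟩
  · rw [hw0, mem_cube_zero_iff] at h
    rwa [h]
  · exact (hi j).trans (csInf_le (hbdd.mono (Set.image_mono (hsub j)))
      (Set.mem_image_of_mem f hj))

end Partition

end Ecertify

/-! ### The main theorem -/

theorem mainTheorem3
    -- the dimension, the example whose explanation is certified, the fidelity
    {d : ℕ} (hd : 0 < d) (x₀ : Fin d → ℝ) (f : (Fin d → ℝ) → ℝ) (hf : Measurable f)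
    -- the half-widths `0 = w 0 < w 1 < ... < w c` and the standard deviations of the Gaussians
    {c : ℕ} (w : Fin (c + 1) → ℝ) (hw0 : w 0 = 0) (hw : StrictMono w)
    (σ : Fin c → ℝ) (hσ : ∀ i, 0 < σ i)
    -- the minimum fidelities are finite
    (hbdd : BddBelow (f '' cube x₀ (w (Fin.last c))))
    -- the sampling strategy, and the `Q` examples that it samples in each of the regions
    (s : Strategy)
    {Ω : Type*} [MeasurableSpace Ω] (P : Measure Ω) [IsProbabilityMeasure P]
    (X : (i : Fin c) → (Q : ℕ) → Ω → Fin Q → Fin d → ℝ)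
    (hX : ∀ i Q, 2 ≤ Q →
      HasLaw (X i Q) (sampleLaw (region x₀ (w i.castSucc) (w i.succ)) (σ i) Q s) P) :
    -- each region
    (∀ (i : Fin c) (κ : ℝ), 0 < κ →
      TailCondition f (region x₀ (w i.castSucc) (w i.succ)) (σ i) κ s →
      (∀ α : ℝ, 0 < α → α < 1 → ∀ ε : ℕ → Ω → ℝ, HasEvtLevel f κ (X i) α ε →
        Tendsto (fun Q => P.real {ω | smallest f (X i Q ω)
            - minFidelity f (region x₀ (w i.castSucc) (w i.succ)) ≤ ε Q ω}) atTop (𝓝 α)) ∧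
      (∀ ε : ℝ, 0 < ε →
        TendstoInMeasure P
          (fun Q ω => P.real {ω' | smallest f (X i Q ω')
              - minFidelity f (region x₀ (w i.castSucc) (w i.succ)) ≤ ε}
            - evtBound f κ (X i Q ω) ε) atTop (fun _ => 0))) ∧
    -- a region that attains the overall minimum
    (∀ (i : Fin c) (κ : ℝ), 0 < κ →
      TailCondition f (region x₀ (w i.castSucc) (w i.succ)) (σ i) κ s →
      (∀ j : Fin c, minFidelity f (region x₀ (w i.castSucc) (w i.succ))
        ≤ minFidelity f (region x₀ (w j.castSucc) (w j.succ))) →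
      minFidelity f (region x₀ (w i.castSucc) (w i.succ)) ≤ f x₀ →
      (∀ α : ℝ, 0 < α → α < 1 → ∀ ε : ℕ → Ω → ℝ, HasEvtLevel f κ (X i) α ε →
        Tendsto (fun Q => P.real {ω | smallest f (X i Q ω)
            - minFidelity f (cube x₀ (w (Fin.last c))) ≤ ε Q ω}) atTop (𝓝 α) ∧
        α ≤ liminf (fun Q => P.real {ω | (⨅ j : Fin c, smallest f (X j Q ω))
            - minFidelity f (cube x₀ (w (Fin.last c))) ≤ ε Q ω}) atTop) ∧
      (∀ ε : ℝ, 0 < ε → ∀ δ : ℝ, 0 < δ →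
        Tendsto (fun Q => P.real {ω |
            P.real {ω' | (⨅ j : Fin c, smallest f (X j Q ω'))
              - minFidelity f (cube x₀ (w (Fin.last c))) ≤ ε}
            < evtBound f κ (X i Q ω) ε - δ}) atTop (𝓝 0))) := by
  -- The sample law has mass one because it is the law of a random variable under the probability
  -- measure `P`.
  have hprob : ∀ i Q, 2 ≤ Q → IsProbabilityMeasure
      (sampleLaw (region x₀ (w i.castSucc) (w i.succ)) (σ i) Q s) := fun i Q hQ =>
    (hX i Q hQ).isProbabilityMeasure_iff.1 inferInstance
  have hlb : ∀ i : Fin c, 0 ≤ w i.castSucc := fun i => hw0 ▸ hw.monotone (Fin.zero_le _)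
  have hub : ∀ i : Fin c, w i.castSucc < w i.succ := fun i => hw Fin.castSucc_lt_succ
  have hreg := fun (i : Fin c) (κ : ℝ) (hκ : 0 < κ)
    (ht : TailCondition f (region x₀ (w i.castSucc) (w i.succ)) (σ i) κ s) =>
    regularClass_exampleLaws hd (hlb i) (hub i) (hσ i) hκ hf ht
  have hmix := fun (i : Fin c) (κ : ℝ) (hκ : 0 < κ)
    (ht : TailCondition f (region x₀ (w i.castSucc) (w i.succ)) (σ i) κ s) (Q : ℕ) (hQ : 2 ≤ Q) =>
    isMixtureOfIID_sampleLaw hd (hlb i) (hub i) hQ (hreg i κ hκ ht).prob (hprob i Q hQ)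
  refine ⟨fun i κ hκ ht => ⟨fun α hα0 hα1 ε hε => ?_, fun ε hε => ?_⟩, fun i κ hκ ht hi h0 => ?_⟩
  · exact (hreg i κ hκ ht).tendsto_level hf hκ (hmix i κ hκ ht) (hX i) hα0 hα1 hε
  · exact (hreg i κ hκ ht).tendstoInMeasure hf hκ (hmix i κ hκ ht) (hX i) hε
  rw [minFidelity_cube_eq hw0 hw hd hbdd hi h0]
  set a := minFidelity f (region x₀ (w i.castSucc) (w i.succ)) with ha
  have hinf : ∀ (Q : ℕ) (ω : Ω), (⨅ j : Fin c, smallest f (X j Q ω)) ≤ smallest f (X i Q ω) :=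
    fun Q ω => ciInf_le (Set.finite_range _).bddBelow i
  have hle : ∀ (Q : ℕ) (ε : Ω → ℝ), P.real {ω | smallest f (X i Q ω) - a ≤ ε ω}
      ≤ P.real {ω | (⨅ j : Fin c, smallest f (X j Q ω)) - a ≤ ε ω} := fun Q ε =>
    measureReal_mono fun ω hω => (sub_le_sub_right (hinf Q ω) a).trans hω
  refine ⟨fun α hα0 hα1 ε hε => ?_, fun ε hε δ hδ => ?_⟩
  · have hlim := (hreg i κ hκ ht).tendsto_level hf hκ (hmix i κ hκ ht) (hX i) hα0 hα1 hε
    refine ⟨hlim, ?_⟩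
    rw [← hlim.liminf_eq]
    exact liminf_le_liminf (Eventually.of_forall fun Q => hle Q (ε Q))
      hlim.isBoundedUnder_ge
      (isBoundedUnder_of ⟨1, fun _ => measureReal_le_one⟩ : IsBoundedUnder (· ≤ ·) atTop
        _).isCoboundedUnder_ge
  · refine tendsto_const_nhds.congr' ?_
    filter_upwards [((hreg i κ hκ ht).tendsto_smallest hf (hmix i κ hκ ht) (hX i)
      hε).eventually_const_lt (u := 1 - δ) (by linarith), eventually_ge_atTop 2] with Q hQ hQ2
    -- The deterministic probability exceeds `1 - δ` for large `Q`, while `evtBound` never exceeds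
    -- `1`.
    have hempty : {ω | P.real {ω' | (⨅ j : Fin c, smallest f (X j Q ω')) - a ≤ ε}
        < evtBound f κ (X i Q ω) ε - δ} = ∅ := by
      refine Set.eq_empty_of_forall_notMem fun ω hω => ?_
      have h1 : P.real {ω' | (⨅ j : Fin c, smallest f (X j Q ω')) - a ≤ ε}
        < evtBound f κ (X i Q ω) ε - δ := hω
      have h2 := evtBound_le_one (f := f) hQ2 hκ hε (X i Q ω)
      have h3 := hle Q fun _ => ε
      linarith
    rw [hempty, measureReal_empty]
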